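/- All matroids are finite, and membership in a class and the relation "is a minor of" are understood up to isomorphism. Definitions. Write $r_M$ for the rank function of a matroid $M$. (1) Let $F$ be a flat of a matroid $M$. A principal extension of $M$ into $F$ is a matroid $M'$ on a ground set $E(M)\cup\{e\}$, where $e\notin E(M)$, such that $M'\setminus e=M$ and a subset of $E(M)$ spans $e$ in $M'$ if and only if it spans $F$. A class of matroids is natural when it is closed under isomorphism, minors, adding coloops, principal extensions, and direct sums. (2) The local connectivity of two sets $S,T\subseteq E(M)$ is $\sqcap_M(S,T)=r_M(S)+r_M(T)-r_M(S\cup T)$. A $3$-separation of $M$ is a partition $(S_1,S_2)$ of $E(M)$ with $|S_1|,|S_2|\ge 3$ and $\sqcap_M(S_1,S_2)<3$. (3) Let $e$ be a non-loop element of a matroid $M$. Then $M$ is a pinned extension into a $3$-separation of $M\setminus e$ if there are a $3$-separation $(S_1,S_2)$ of $M\setminus e$ and sets $Y_1\subseteq S_1$ and $Y_2\subseteq S_2$ such that $\sqcap_{M\setminus e}(Y_1,S_2)=\sqcap_{M\setminus e}(S_1,Y_2)=1$ and $e$ is spanned in $M$ by both $Y_1$ and $Y_2$. A class $\mathcal M$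 is closed under pinned extensions into $3$-separations if $M\in\mathcal M$ whenever $M$ is a pinned extension into a $3$-separation of $M\setminus e$ for some $e$ with $M\setminus e\in\mathcal M$. (4) An excluded minor for a class $\mathcal M$ is a matroid that is not in $\mathcal M$ but all of whose proper minors are in $\mathcal M$. Theorem. Let $\mathcal M_1$ and $\mathcal M_2$ be natural classes of matroids with $\mathcal M_1\subsetneq\mathcal M_2$, and suppose that $\mathcal M_1$ is closed under pinned extensions into $3$-separations. Then each matroid in $\mathcal M_1$ is a minor of an excluded minor for $\mathcal M_1$ that is also in $\mathcal M_2$. -/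

import Mathlib

universe u

namespace Matroid

/-- Two matroids, possibly on different ambient types, are isomorphic: some bijection between their
ground sets preserves independence in both directions. -/
def Isomorphic {α β : Type*} (M : Matroid α) (N : Matroid β) : Prop :=
  ∃ φ : M.E ≃ N.E, ∀ I : Set M.E,
    M.Indep ((fun x : M.E => (x : α)) '' I) ↔ N.Indep ((fun x : M.E => (φ x : β)) '' I)

/-- The rank of a set in a matroid, as a natural number (meaningful for finite matroids). -/
noncomputable def rankOf {α : Type*} (M : Matroid α) (X : Set α) : ℕ := (M.eRk X).toNat

/-- The local connectivity `⊓_M(S, T) = r(S) + r(T) - r(S ∪ T)`, as an integer. -/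
noncomputable def localConn {α : Type*} (M : Matroid α) (S T : Set α) : ℤ :=
  (M.rankOf S : ℤ) + M.rankOf T - M.rankOf (S ∪ T)

/-- `M'` is obtained from `M` by adding the new element `e` as a coloop. -/
def IsColoopExtension {α : Type*} (M : Matroid α) (e : α) (M' : Matroid α) : Prop :=
  e ∉ M.E ∧ M'.E = insert e M.E ∧ M' ＼ {e} = M ∧ M'.IsColoop e

/-- `M'` is the principal extension of `M` into the flat `F` by the new element `e`: deleting `e`
gives `M`, and a subset of `E(M)` spans `e` if and only if it spans `F`. -/
def IsPrincipalExtension {α : Type*} (M : Matroid α) (F : Set α) (e : α) (M' : Matroid α) : Prop :=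
  M.IsFlat F ∧ e ∉ M.E ∧ M'.E = insert e M.E ∧ M' ＼ {e} = M ∧
    ∀ X ⊆ M.E, (e ∈ M'.closure X ↔ F ⊆ M'.closure X)

/-- `(S₁, S₂)` is a `3`-separation of `M`: a partition of `E(M)` into two sets with at least three
elements each, with `r(S₁) + r(S₂) - r(M) < 3`. -/
def IsThreeSeparation {α : Type*} (M : Matroid α) (S₁ S₂ : Set α) : Prop :=
  S₁ ∪ S₂ = M.E ∧ Disjoint S₁ S₂ ∧ 3 ≤ S₁.encard ∧ 3 ≤ S₂.encard ∧ M.localConn S₁ S₂ < 3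

/-- `e` is a non-loop of `M`, and `M` is a pinned extension into a `3`-separation of `M ＼ e`. -/
def IsPinnedExtension {α : Type*} (M : Matroid α) (e : α) : Prop :=
  M.IsNonloop e ∧ ∃ S₁ S₂ Y₁ Y₂ : Set α,
    (M ＼ {e}).IsThreeSeparation S₁ S₂ ∧ Y₁ ⊆ S₁ ∧ Y₂ ⊆ S₂ ∧
    (M ＼ {e}).localConn Y₁ S₂ = 1 ∧ (M ＼ {e}).localConn S₁ Y₂ = 1 ∧
    e ∈ M.closure Y₁ ∧ e ∈ M.closure Y₂

end Matroid

/-- A class of matroids. As usual in this setting, matroids have finite ground sets. -/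
structure MatroidClass where
  /-- membership of a matroid in the class -/
  Mem : ∀ ⦃α : Type u⦄, Matroid α → Prop
  /-- all members are finite matroids -/
  finite_of_mem : ∀ ⦃α : Type u⦄ (M : Matroid α), Mem M → M.Finite

namespace MatroidClass

/-- `𝓜₁` is a proper subclass of `𝓜₂`. -/
def ProperSubclass (𝓜₁ 𝓜₂ : MatroidClass.{u}) : Prop :=
  (∀ (α : Type u) (M : Matroid α), 𝓜₁.Mem M → 𝓜₂.Mem M) ∧
    ∃ (α : Type u) (M : Matroid α), 𝓜₂.Mem M ∧ ¬ 𝓜₁.Mem M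

/-- A class is natural when it is closed under isomorphism, minors, adding coloops, principal
extensions, and direct sums. -/
structure IsNatural (𝓜 : MatroidClass.{u}) : Prop where
  isomorphic : ∀ (α β : Type u) (M : Matroid α) (N : Matroid β),
    𝓜.Mem M → M.Isomorphic N → 𝓜.Mem N
  minor : ∀ (α : Type u) (M N : Matroid α), 𝓜.Mem M → N.IsMinor M → 𝓜.Mem N
  coloop : ∀ (α : Type u) (M M' : Matroid α) (e : α),
    𝓜.Mem M → M.IsColoopExtension e M' → 𝓜.Mem M'
  principal : ∀ (α : Type u) (M M' : Matroid α) (F : Set α) (e : α),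
    𝓜.Mem M → M.IsPrincipalExtension F e M' → 𝓜.Mem M'
  directSum : ∀ (α : Type u) (M N : Matroid α) (h : Disjoint M.E N.E),
    𝓜.Mem M → 𝓜.Mem N → 𝓜.Mem (M.disjointSum N h)

/-- If a member of the class has a pinned extension into one of its `3`-separations, then this
extension is again in the class. -/
def ClosedUnderPinnedExtensions (𝓜 : MatroidClass.{u}) : Prop :=
  ∀ (α : Type u) (M : Matroid α) (e : α),
    𝓜.Mem (M.delete {e}) → M.IsPinnedExtension e → 𝓜.Mem M

/-- A (finite) matroid is an excluded minor for a class when it is not in the class but all of its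
proper minors are. -/
def IsExcludedMinor (𝓜 : MatroidClass.{u}) {α : Type u} (L : Matroid α) : Prop :=
  L.Finite ∧ ¬ 𝓜.Mem L ∧ ∀ N : Matroid α, N.IsStrictMinor L → 𝓜.Mem N

end MatroidClass

/-!
Among the members of `𝓜₂` outside `𝓜₁` choose `R` with as few elements, and then as few dependent
sets, as possible. It has two incomparable elements `e` and `e'`: some set spans `e` and not `e'`,
and some set spans `e'` and not `e`. For otherwise `R` has a freest element, and so is a principal
extension, or an extension by a coloop, of a member of `𝓜₁`. Add to `R` a point `p`, placed freely
on the line through `e` and `e'`. Deleting `e` or `e'` then yields a member of `𝓜₁`, since replacing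
`e` or `e'` by `p` decreases the number of dependent sets.

From `N` one builds a gadget: a member `G` of `𝓜₁` that contains `N` and has two incomparable
elements `g` and `g'`, which become comparable when any other element is deleted or contracted.
Amalgamate `R + p` and `G`, identifying `e` with `g` and `e'` with `g'`, and delete the two
identified points. The result lies in `𝓜₂` but not in `𝓜₁`, because putting back first `e` and then
`e'` is a pinned extension into a 3-separation each time, and recovers `R`. But contracting any
element of it, or deleting an element of the gadget, gives a member of `𝓜₁`: once `g` and `g'` are
comparable, the amalgam can be built from `(R + p) ∖ e` or `(R + p) ∖ e'` instead. So an excluded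
minor for `𝓜₁` inside it uses the whole gadget, and therefore has `N` as a minor.
-/

open Set Matroid

section FreeExtension

variable {α : Type*} {M P Q : Matroid α} {C D F F' I J X : Set α} {e f x y : α}

lemma closure_eq_closure_of_ncard_le (hI : M.Indep I) (hJ : M.Indep J) (hJfin : J.Finite)
    (hIJ : I ⊆ M.closure J) (h : J.ncard ≤ I.ncard) : M.closure I = M.closure J := by
  have hIfin : I.Finite := by
    rw [← encard_lt_top_iff, ← hI.eRk_eq_encard]
    exact ((M.eRk_mono hIJ).trans_eq (by simp)).trans_lt
      ((M.eRk_le_encard J).trans_lt hJfin.encard_lt_top)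
  have hrk : M.eRk (M.closure J) ≤ M.eRk I := by
    rw [eRk_closure_eq, hI.eRk_eq_encard, hJ.eRk_eq_encard, ← hIfin.cast_ncard_eq,
      ← hJfin.cast_ncard_eq]
    exact_mod_cast h
  rw [(hI.isBasis'_of_eRk_ge hIfin hIJ hrk).closure_eq_closure, closure_closure]

lemma exists_insert_not_subset_closure [M.Finite] (hI : M.Indep I) (hJ : M.Indep J)
    (hFI : ¬ F ⊆ M.closure I) (hIJ : I.ncard < J.ncard)
    (hFJ : F ⊆ M.closure J → I.ncard + 1 < J.ncard) :
    ∃ x ∈ J \ I, M.Indep (insert x I) ∧ ¬ F ⊆ M.closure (insert x I) := by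
  obtain ⟨f, hfF, hfI⟩ := not_subset.1 hFI
  by_contra! hcon
  have hI_fin := M.set_finite I hI.subset_ground
  have hJ_fin := M.set_finite J hJ.subset_ground
  have hspan : ∀ x ∈ J, x ∉ M.closure I → F ⊆ M.closure (insert x I) := fun x hx hxI ↦
    have hxI' : x ∉ I := fun h ↦ hxI (M.subset_closure I hI.subset_ground h)
    hcon x ⟨hx, hxI'⟩ ((hI.insert_indep_iff_of_notMem hxI').2 ⟨hJ.subset_ground hx, hxI⟩)
  -- Exchanging `f` with `x` puts `J` inside the closure of `I + f`, so `J` has at most `|I| + 1`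
  -- elements.
  have hfE : f ∈ M.E := by
    obtain ⟨x, hx, hxI⟩ := hI.augment hJ (by
      rwa [← hI_fin.cast_ncard_eq, ← hJ_fin.cast_ncard_eq, Nat.cast_lt])
    exact M.closure_subset_ground _ (hcon x hx hxI hfF)
  have hIf : M.Indep (insert f I) := hI.insert_indep_iff.2 (.inl ⟨hfE, hfI⟩)
  have hJf : J ⊆ M.closure (insert f I) := fun x hx ↦ by
    by_cases hxI : x ∈ M.closure I
    · exact M.closure_subset_closure (subset_insert f I) hxI
    · exact (closure_exchange ⟨hspan x hx hxI hfF, hfI⟩).1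
  have hcard : (insert f I).ncard = I.ncard + 1 :=
    ncard_insert_of_notMem (fun h ↦ hfI (M.subset_closure I hI.subset_ground h)) hI_fin
  have hclJ := closure_eq_closure_of_ncard_le hJ hIf (hI_fin.insert f) hJf (by lia)
  obtain ⟨x, hxJ, hxI⟩ : ∃ x ∈ J, x ∉ M.closure I := not_subset.1 fun h ↦
    hfI (M.closure_subset_closure_of_subset_closure h (hclJ ▸ M.mem_closure_of_mem (mem_insert f I)
      hIf.subset_ground))
  have hclx : M.closure (insert f I) = M.closure (insert x I) :=
    closure_insert_congr ⟨hspan x hxJ hxI hfF, hfI⟩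
  have hFclJ : F ⊆ M.closure J := hclJ ▸ hclx ▸ hspan x hxJ hxI
  have hJ_le : J.ncard ≤ I.ncard + 1 := by
    have := (M.eRk_mono hJf).trans (M.eRk_closure_eq _).le
    rw [hJ.eRk_eq_encard, hIf.eRk_eq_encard, ← hJ_fin.cast_ncard_eq,
      ← (hI_fin.insert f).cast_ncard_eq, hcard] at this
    exact_mod_cast this
  exact absurd (hFJ hFclJ) (by lia)

/-- The independent sets of the matroid obtained from `M` by placing the new element `e` freely on
the flat spanned by `F`. -/
def FreeExtIndep (M : Matroid α) (F : Set α) (e : α) (I : Set α) : Prop :=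
  M.Indep (I \ {e}) ∧ (e ∈ I → ¬ F ⊆ M.closure (I \ {e}))

lemma FreeExtIndep.subset (hJ : FreeExtIndep M F e J) (hIJ : I ⊆ J) : FreeExtIndep M F e I :=
  have hsub : I \ {e} ⊆ J \ {e} := sdiff_subset_sdiff_left hIJ
  ⟨hJ.1.subset hsub, fun heI h ↦ hJ.2 (hIJ heI) (h.trans (M.closure_subset_closure hsub))⟩

lemma FreeExtIndep.subset_insert (hI : FreeExtIndep M F e I) : I ⊆ insert e M.E :=
  sdiff_singleton_subset_iff.1 hI.1.subset_ground

lemma freeExtIndep_iff_of_notMem (he : e ∉ I) : FreeExtIndep M F e I ↔ M.Indep I := by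
  simp [FreeExtIndep, he]

lemma freeExtIndep_insert_iff (he : e ∉ I) :
    FreeExtIndep M F e (insert e I) ↔ M.Indep I ∧ ¬ F ⊆ M.closure I := by
  simp [FreeExtIndep, insert_sdiff_self_of_notMem he]

lemma FreeExtIndep.augment [M.Finite] (hI : FreeExtIndep M F e I) (hJ : FreeExtIndep M F e J)
    (hIJ : I.ncard < J.ncard) : ∃ x ∈ J, x ∉ I ∧ FreeExtIndep M F e (insert x I) := by
  have hI_fin := (M.ground_finite.insert e).subset hI.subset_insert
  have hJ_fin := (M.ground_finite.insert e).subset hJ.subset_insert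
  have hJ_card : (J \ {e}).ncard = J.ncard ∧ e ∉ J ∨ (J \ {e}).ncard + 1 = J.ncard ∧ e ∈ J := by
    by_cases he : e ∈ J
    · exact .inr ⟨ncard_sdiff_singleton_add_one he hJ_fin, he⟩
    · exact .inl ⟨by rw [sdiff_singleton_eq_self he], he⟩
  by_cases heI : e ∈ I
  · have hI_card := ncard_sdiff_singleton_add_one heI hI_fin
    obtain ⟨x, ⟨hxJ, hxI⟩, hind, hspan⟩ := exists_insert_not_subset_closure hI.1 hJ.1 (hI.2 heI)
      (by lia) (fun h ↦ by have := hJ.2; grind)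
    refine ⟨x, hxJ.1, fun h ↦ hxI ⟨h, hxJ.2⟩, ?_⟩
    rw [FreeExtIndep, insert_sdiff_of_notMem _ hxJ.2]
    exact ⟨hind, fun _ ↦ hspan⟩
  have hI' : M.Indep I := (freeExtIndep_iff_of_notMem heI).1 hI
  by_cases hsub : J \ {e} ⊆ M.closure I
  · have hle : (J \ {e}).ncard ≤ I.ncard := by
      have := (M.eRk_mono hsub).trans (M.eRk_closure_eq _).le
      rw [hJ.1.eRk_eq_encard, hI'.eRk_eq_encard, ← hI_fin.cast_ncard_eq,
        ← hJ_fin.sdiff.cast_ncard_eq] at this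
      exact_mod_cast this
    have heJ : e ∈ J := by lia
    have hcl := closure_eq_closure_of_ncard_le hJ.1 hI' hI_fin hsub (by lia)
    exact ⟨e, heJ, heI, (freeExtIndep_insert_iff heI).2 ⟨hI', hcl ▸ hJ.2 heJ⟩⟩
  obtain ⟨x, ⟨hxJ, hxe⟩, hxI⟩ := not_subset.1 hsub
  refine ⟨x, hxJ, fun h ↦ hxI (M.subset_closure I hI'.subset_ground h), ?_⟩
  rw [freeExtIndep_iff_of_notMem (by simp [heI, Ne.symm hxe])]
  exact hI'.insert_indep_iff.2 (.inl ⟨hJ.1.subset_ground ⟨hxJ, hxe⟩, hxI⟩)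

/-- The matroid obtained from `M` by placing the new element `e` freely on the flat spanned by
`F`. -/
def freeExt (M : Matroid α) [M.Finite] (F : Set α) (e : α) : Matroid α :=
  (IndepMatroid.ofFinite (M.ground_finite.insert e) (FreeExtIndep M F e)
    (by simp [FreeExtIndep]) (fun _ _ ↦ FreeExtIndep.subset) (fun _ _ ↦ FreeExtIndep.augment)
    (fun _ ↦ FreeExtIndep.subset_insert)).matroid

/-- `P` is the principal extension of `M` by `e` into the flat spanned by `F`, where `F` itself need
not be a flat. -/
structure IsFreeExt (M : Matroid α) (F : Set α) (e : α) (P : Matroid α) : Prop where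
  subset_ground : F ⊆ M.E
  notMem : e ∉ M.E
  ground_eq : P.E = insert e M.E
  delete_eq : P ＼ {e} = M
  mem_closure_iff : ∀ X ⊆ M.E, e ∈ P.closure X ↔ F ⊆ M.closure X

lemma isFreeExt_freeExt [M.Finite] (hF : F ⊆ M.E) (he : e ∉ M.E) :
    IsFreeExt M F e (freeExt M F e) := by
  have hindep : ∀ I, (freeExt M F e).Indep I ↔ FreeExtIndep M F e I := fun _ ↦ Iff.rfl
  have hdel : freeExt M F e ＼ {e} = M := by
    have hE : (freeExt M F e).E = insert e M.E := rfl
    refine ext_indep (by simp [hE, he]) fun I hI ↦ ?_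
    have heI : e ∉ I := fun h ↦ (hI h).2 rfl
    rw [deleteElem_indep_iff, hindep, freeExtIndep_iff_of_notMem heI, and_iff_left heI]
  refine ⟨hF, he, rfl, hdel, fun X hX ↦ ?_⟩
  obtain ⟨I, hI⟩ := M.exists_isBasis X
  have heI : e ∉ I := fun h ↦ he (hX (hI.subset h))
  have hIP : (freeExt M F e).IsBasis I X := by
    rw [← hdel] at hI
    exact hI.of_delete
  have hIe : insert e I ⊆ (freeExt M F e).E := insert_subset_insert hI.indep.subset_ground
  rw [← hIP.closure_eq_closure, ← hI.closure_eq_closure, hIP.indep.mem_closure_iff_of_notMem heI,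
    ← not_indep_iff, hindep, freeExtIndep_insert_iff heI]
  simp [hI.indep]

lemma ext_deleteElem {M N : Matroid α} (hM : e ∈ M.E) (hN : e ∈ N.E) (hMN : M ＼ {e} = N ＼ {e})
    (hcl : ∀ X ⊆ M.E \ {e}, e ∈ M.closure X ↔ e ∈ N.closure X) : M = N := by
  have hE : M.E = N.E := by
    rw [← insert_sdiff_self_of_mem hM, ← insert_sdiff_self_of_mem hN]
    exact congrArg (fun L ↦ insert e L.E) hMN
  have hindep {I : Set α} (heI : e ∉ I) : M.Indep I ↔ N.Indep I := by
    rw [← and_iff_left (a := M.Indep I) heI, ← and_iff_left (a := N.Indep I) heI,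
      ← deleteElem_indep_iff, hMN, deleteElem_indep_iff]
  refine ext_indep hE fun I hI ↦ ?_
  by_cases heI : e ∈ I
  · have hI' : I \ {e} ⊆ M.E \ {e} := sdiff_subset_sdiff_left hI
    have heI' : e ∉ I \ {e} := fun h ↦ h.2 rfl
    rw [← insert_sdiff_self_of_mem heI, insert_indep_iff, insert_indep_iff, hindep heI']
    simp [hM, hN, hcl _ hI']
  · exact hindep heI

lemma isFreeExt_deleteElem {M : Matroid α} (he : e ∈ M.E) (hF : F ⊆ M.E \ {e})
    (h : ∀ X ⊆ M.E \ {e}, e ∈ M.closure X ↔ F ⊆ M.closure X) : IsFreeExt (M ＼ {e}) F e M where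
  subset_ground := hF
  notMem h := h.2 rfl
  ground_eq := by rw [delete_ground, insert_sdiff_self_of_mem he]
  delete_eq := rfl
  mem_closure_iff X hX := by
    rw [delete_closure_eq_of_disjoint _ (subset_sdiff.1 hX).2, subset_sdiff,
      and_iff_left (subset_sdiff.1 hF).2, h X hX]

namespace IsFreeExt

lemma finite [M.Finite] (h : IsFreeExt M F e P) : P.Finite :=
  ⟨h.ground_eq ▸ M.ground_finite.insert e⟩

lemma mem_ground (h : IsFreeExt M F e P) : e ∈ P.E := h.ground_eq ▸ mem_insert e M.E

lemma ground_subset (h : IsFreeExt M F e P) : M.E ⊆ P.E := h.ground_eq ▸ Set.subset_insert e M.E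

lemma closure_sdiff_eq (h : IsFreeExt M F e P) (hX : X ⊆ M.E) :
    P.closure X \ {e} = M.closure X := by
  rw [← h.delete_eq, delete_closure_eq_of_disjoint]
  exact disjoint_singleton_right.2 fun heX ↦ h.notMem (hX heX)

lemma mem_closure_iff_of_mem (h : IsFreeExt M F e P) (hX : X ⊆ M.E) (hf : f ∈ M.E) :
    f ∈ P.closure X ↔ f ∈ M.closure X := by
  have hfe : f ≠ e := fun hfe ↦ h.notMem (hfe ▸ hf)
  simp [← h.closure_sdiff_eq hX, hfe]

lemma closure_subset (h : IsFreeExt M F e P) (X : Set α) : M.closure X ⊆ P.closure X := by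
  rw [← h.delete_eq, delete_closure_eq]
  exact sdiff_subset.trans (P.closure_subset_closure sdiff_subset)

lemma subset_closure_iff (h : IsFreeExt M F e P) (hX : X ⊆ M.E) (hD : D ⊆ M.E) :
    D ⊆ P.closure X ↔ D ⊆ M.closure X :=
  forall₂_congr fun _ hd ↦ h.mem_closure_iff_of_mem hX (hD hd)

lemma isPrincipalExtension (h : IsFreeExt M F e P) :
    M.IsPrincipalExtension (M.closure F) e P := by
  refine ⟨M.isFlat_closure F, h.notMem, h.ground_eq, h.delete_eq, fun X hX ↦ ?_⟩
  rw [h.mem_closure_iff X hX, h.subset_closure_iff hX (M.closure_subset_ground F),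
    M.closure_subset_closure_iff_subset_closure h.subset_ground]

lemma indep_iff (h : IsFreeExt M F e P) (hI : I ⊆ M.E) : P.Indep I ↔ M.Indep I := by
  rw [← h.delete_eq, deleteElem_indep_iff, and_iff_left fun he ↦ h.notMem (hI he)]

lemma eRk_eq (h : IsFreeExt M F e P) (hX : X ⊆ M.E) : P.eRk X = M.eRk X := by
  obtain ⟨I, hI⟩ := M.exists_isBasis X
  rw [← hI.encard_eq_eRk, (h.delete_eq ▸ hI : (P ＼ {e}).IsBasis I X).of_delete.encard_eq_eRk]

lemma mem_closure_pair {a b : α} (h : IsFreeExt M {a, b} e P) : b ∈ P.closure {e, a} := by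
  obtain ⟨ha, hb⟩ := pair_subset_iff.1 h.subset_ground
  have ha' : {a} ⊆ M.E := singleton_subset_iff.2 ha
  by_cases hba : b ∈ M.closure {a}
  · exact P.closure_subset_closure (by simp) ((h.mem_closure_iff_of_mem ha' hb).2 hba)
  refine (closure_exchange ⟨?_, fun hea ↦ hba ?_⟩).1
  · rw [h.mem_closure_iff _ (insert_subset hb ha'), pair_comm]
    exact M.subset_closure _ (insert_subset hb ha')
  · exact (h.mem_closure_iff _ ha').1 hea (by simp)

lemma isBase (h : IsFreeExt M F e P) (hI : M.IsBase I) : P.IsBase I := by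
  refine ((h.indep_iff hI.subset_ground).2 hI.indep).isBase_of_ground_subset_closure ?_
  rw [h.ground_eq, insert_subset_iff, h.mem_closure_iff I hI.subset_ground,
    h.subset_closure_iff hI.subset_ground subset_rfl, hI.closure_eq]
  exact ⟨h.subset_ground, subset_rfl⟩

lemma delete (h : IsFreeExt M F e P) (heD : e ∉ D) (hFD : Disjoint F D) :
    IsFreeExt (M ＼ D) F e (P ＼ D) where
  subset_ground := subset_sdiff.2 ⟨h.subset_ground, hFD⟩
  notMem he := h.notMem he.1
  ground_eq := by rw [delete_ground, h.ground_eq, insert_sdiff_of_notMem _ heD, delete_ground]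
  delete_eq := by rw [delete_comm, h.delete_eq]
  mem_closure_iff X hX := by
    have hXD : Disjoint X D := (subset_sdiff.1 hX).2
    rw [delete_closure_eq_of_disjoint _ hXD, delete_closure_eq_of_disjoint _ hXD, subset_sdiff,
      and_iff_left hFD, mem_sdiff, and_iff_left heD, h.mem_closure_iff X (hX.trans sdiff_subset)]

lemma contract (h : IsFreeExt M F e P) (hC : C ⊆ M.E) (hFC : Disjoint F C) :
    IsFreeExt (M ／ C) F e (P ／ C) where
  subset_ground := subset_sdiff.2 ⟨h.subset_ground, hFC⟩
  notMem he := h.notMem he.1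
  ground_eq := by
    rw [contract_ground, h.ground_eq, insert_sdiff_of_notMem _ fun he ↦ h.notMem (hC he),
      contract_ground]
  delete_eq := by
    rw [contract_delete_comm _ (disjoint_singleton_right.2 fun he ↦ h.notMem (hC he)), h.delete_eq]
  mem_closure_iff X hX := by
    have heC : e ∉ C := fun he ↦ h.notMem (hC he)
    rw [contract_closure_eq, contract_closure_eq, subset_sdiff, and_iff_left hFC, mem_sdiff,
      and_iff_left heC, h.mem_closure_iff _ (union_subset (hX.trans sdiff_subset) hC)]

/-- Exchange `x` with `y`, and then with an element of `F'`. -/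
lemma subset_closure_insert (hx : IsFreeExt M F x P) (hy : IsFreeExt P F' y Q) (hF' : F' ⊆ M.E)
    (hX : X ⊆ M.E) (h : x ∈ Q.closure (insert y X) \ Q.closure X) :
    F ⊆ Q.closure (insert y X) := by
  have hXP : X ⊆ P.E := hX.trans hx.ground_subset
  have hxX : insert x X ⊆ P.E := insert_subset hx.mem_ground hXP
  have hyx : y ∈ Q.closure (insert x X) := (closure_exchange h).1
  have hF'x : F' ⊆ P.closure (insert x X) := (hy.mem_closure_iff _ hxX).1 hyx
  obtain ⟨f, hfF', hfX⟩ : ∃ f ∈ F', f ∉ P.closure X := not_subset.1 fun hsub ↦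
    h.2 (closure_insert_eq_of_mem_closure ((hy.mem_closure_iff X hXP).2 hsub) ▸ h.1)
  have hf : f ∈ M.E := hF' hfF'
  have hfQ : f ∈ Q.closure (insert y X) := by
    rw [← closure_insert_congr h, hy.mem_closure_iff_of_mem hxX (hx.ground_subset hf)]
    exact hF'x hfF'
  have hxf : x ∈ P.closure (insert f X) := (closure_exchange ⟨hF'x hfF', hfX⟩).1
  have hfX' : insert f X ⊆ M.E := insert_subset hf hX
  rw [hx.mem_closure_iff _ hfX', ← hx.subset_closure_iff hfX' hx.subset_ground,
    ← hy.subset_closure_iff (hfX'.trans hx.ground_subset)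
      (hx.subset_ground.trans hx.ground_subset)] at hxf
  refine hxf.trans (Q.closure_subset_closure_of_subset_closure (insert_subset hfQ ?_))
  exact (subset_insert y X).trans
    (Q.subset_closure _ (hy.ground_eq ▸ insert_subset_insert hXP))

lemma delete_left (hx : IsFreeExt M F x P) (hy : IsFreeExt P F' y Q) (hF' : F' ⊆ M.E) :
    IsFreeExt M F' y (Q ＼ {x}) := by
  have hxy : x ≠ y := fun h ↦ hy.notMem (h ▸ hx.mem_ground)
  refine ⟨hF', fun h ↦ hy.notMem (hx.ground_subset h), ?_, ?_, fun X hX ↦ ?_⟩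
  · rw [delete_ground, hy.ground_eq, hx.ground_eq, insert_comm,
      insert_sdiff_self_of_notMem (by simp [hx.notMem, hxy])]
  · rw [delete_comm, hy.delete_eq, hx.delete_eq]
  · rw [delete_closure_eq_of_disjoint _ (disjoint_singleton_right.2 fun h ↦ hx.notMem (hX h)),
      mem_sdiff, and_iff_left (by simpa using hxy.symm),
      hy.mem_closure_iff X (hX.trans hx.ground_subset), hx.subset_closure_iff hX hF']

/-- The elements `x` and `y` can be added in either order. -/
lemma comm (hx : IsFreeExt M F x P) (hy : IsFreeExt P F' y Q) (hF' : F' ⊆ M.E) :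
    IsFreeExt (Q ＼ {x}) F x Q := by
  have hground : (Q ＼ {x}).E = insert y M.E := (hx.delete_left hy hF').ground_eq
  have hFP : F ⊆ P.E := hx.subset_ground.trans hx.ground_subset
  have hxF : Disjoint F {x} := disjoint_singleton_right.2 fun h ↦ hx.notMem (hx.subset_ground h)
  have hclosure {X : Set α} (hX : X ⊆ M.E) : x ∈ Q.closure X ↔ F ⊆ Q.closure X := by
    rw [hy.mem_closure_iff_of_mem (hX.trans hx.ground_subset) hx.mem_ground,
      hx.mem_closure_iff _ hX, ← hx.subset_closure_iff hX hx.subset_ground,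
      ← hy.subset_closure_iff (hX.trans hx.ground_subset) hFP]
  refine ⟨(hx.subset_ground.trans (Set.subset_insert y M.E)).trans hground.ge, by simp,
    by rw [hground, insert_comm, ← hx.ground_eq, hy.ground_eq], rfl, fun X hX ↦ ?_⟩
  rw [delete_closure_eq_of_disjoint _ (disjoint_singleton_right.2 fun h ↦ (hX h).2 rfl),
    subset_sdiff, and_iff_left hxF]
  refine ⟨fun hxX ↦ ?_, fun hF ↦ Q.closure_subset_closure_of_subset_closure hF ?_⟩
  · have hXM : X \ {y} ⊆ M.E := sdiff_singleton_subset_iff.2 (hground ▸ hX)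
    by_cases hxXy : x ∈ Q.closure (X \ {y})
    · exact ((hclosure hXM).1 hxXy).trans (Q.closure_subset_closure sdiff_subset)
    have hyX : y ∈ X := by_contra fun hyX ↦ hxXy (by rwa [sdiff_singleton_eq_self hyX])
    rw [← insert_sdiff_self_of_mem hyX] at hxX ⊢
    exact hx.subset_closure_insert hy hF' hXM ⟨hxX, hxXy⟩
  · exact (hclosure hx.subset_ground).2 (Q.subset_closure F (hFP.trans hy.ground_subset))

end IsFreeExt

end FreeExtension

section Naturality

variable {α β : Type*} {M : Matroid α} {N : Matroid β}

lemma isomorphic_map (M : Matroid α) (φ : α → β) (hφ : InjOn φ M.E) :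
    M.Isomorphic (M.map φ hφ) := by
  refine ⟨Equiv.Set.imageOfInjOn φ M.E hφ, fun I ↦ ?_⟩
  change M.Indep (Subtype.val '' I) ↔ (M.map φ hφ).Indep ((fun x : M.E ↦ φ x) '' I)
  rw [← image_image φ Subtype.val, map_image_indep_iff (by simp)]

lemma isomorphic_symm (h : M.Isomorphic N) : N.Isomorphic M := by
  obtain ⟨φ, hφ⟩ := h
  refine ⟨φ.symm, fun I ↦ ?_⟩
  simpa [image_image] using (hφ (φ.symm '' I)).symm

namespace MatroidClass.IsNatural

variable {α β : Type u} {𝓜 : MatroidClass.{u}} {M N P : Matroid α} {X F : Set α} {e : α}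

lemma map (h : 𝓜.IsNatural) (hM : 𝓜.Mem M) (φ : α → β) (hφ : InjOn φ M.E) :
    𝓜.Mem (M.map φ hφ) :=
  h.isomorphic _ _ _ _ hM (isomorphic_map M φ hφ)

lemma delete (h : 𝓜.IsNatural) (hM : 𝓜.Mem M) (D : Set α) : 𝓜.Mem (M ＼ D) :=
  h.minor _ _ _ hM ⟨∅, D, by rw [contract_empty]⟩

lemma contract (h : 𝓜.IsNatural) (hM : 𝓜.Mem M) (C : Set α) : 𝓜.Mem (M ／ C) :=
  h.minor _ _ _ hM ⟨C, ∅, by rw [delete_empty]⟩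

lemma restrict (h : 𝓜.IsNatural) (hM : 𝓜.Mem M) (hX : X ⊆ M.E) : 𝓜.Mem (M ↾ X) :=
  delete_compl hX ▸ h.delete hM _

lemma isFreeExt (h : 𝓜.IsNatural) (hM : 𝓜.Mem M) (hP : IsFreeExt M F e P) : 𝓜.Mem P :=
  h.principal _ _ _ _ _ hM hP.isPrincipalExtension

/-- If `M` behaves like a restriction of the principal extension of `N` into the span of `F`, then
it is one, even if it lacks some elements of `F`. -/
lemma of_mem_closure_iff {D : Set α} (h : 𝓜.IsNatural) (hN : 𝓜.Mem N) (hF : F ⊆ N.E) (he : e ∈ M.E)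
    (heN : e ∉ N.E) (heD : e ∉ D) (hMN : M ＼ {e} = N ＼ D)
    (hcl : ∀ X ⊆ M.E \ {e}, e ∈ M.closure X ↔ F ⊆ N.closure X) : 𝓜.Mem M := by
  have := 𝓜.finite_of_mem N hN
  have hP := isFreeExt_freeExt hF heN
  have hMP : M = freeExt N F e ＼ D := by
    refine ext_deleteElem he ⟨hP.mem_ground, heD⟩ ?_ fun X hX ↦ ?_
    · rw [hMN, delete_comm, hP.delete_eq]
    · have hXN : X ⊆ N.E \ D := hX.trans (congrArg Matroid.E hMN).subset
      rw [hcl X hX, delete_closure_eq_of_disjoint _ (subset_sdiff.1 hXN).2, mem_sdiff,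
        and_iff_left heD, hP.mem_closure_iff X (hXN.trans sdiff_subset)]
  exact hMP ▸ h.delete (h.isFreeExt hN hP) D

end MatroidClass.IsNatural

end Naturality

section Rank

variable {α : Type*} {M R G : Matroid α} {C X Y : Set α} {e : α}

lemma coe_rankOf [M.RankFinite] (X : Set α) : (M.rankOf X : ℕ∞) = M.eRk X :=
  ENat.natCast_toNat (M.isRkFinite_set X).eRk_lt_top.ne

lemma eRk_contract_add_encard (hC : M.Indep C) (hX : X ⊆ (M ／ C).E) :
    (M ／ C).eRk X + C.encard = M.eRk (X ∪ C) := by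
  obtain ⟨I, hI⟩ := (M ／ C).exists_isBasis X
  have hIC : Disjoint I C := (subset_sdiff.1 hI.indep.subset_ground).2
  rw [← hI.encard_eq_eRk, ← encard_union_eq hIC,
    (hC.union_isBasis_union_of_contract_isBasis hI).encard_eq_eRk]

lemma mem_closure_disjointSum_iff (h : Disjoint R.E G.E) (he : e ∈ R.E) :
    e ∈ (R.disjointSum G h).closure X ↔ e ∈ R.closure X := by
  have heG : e ∉ G.E := h.notMem_of_mem_left he
  rw [← closure_inter_ground _ X, ← R.closure_inter_ground X]
  obtain ⟨I, hI⟩ := (R.disjointSum G h).exists_isBasis (X ∩ (R.disjointSum G h).E)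
  have hIR := (disjointSum_isBasis_iff.1 hI).1
  rw [inter_assoc, disjointSum_ground_eq, inter_eq_self_of_subset_right subset_union_left] at hIR
  rw [← hI.closure_eq_closure, ← hIR.closure_eq_closure, hI.indep.mem_closure_iff',
    hIR.indep.mem_closure_iff', disjointSum_indep_iff, insert_inter_of_mem he,
    insert_inter_of_notMem heG]
  have hII := disjointSum_indep_iff.1 hI.indep
  simp [he, hII.2.1, insert_subset_iff, hII.2.2]

lemma disjointSum_closure_eq (h : Disjoint R.E G.E) (X : Set α) :
    (R.disjointSum G h).closure X = R.closure X ∪ G.closure X := by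
  ext e
  refine ⟨fun he ↦ ?_, ?_⟩
  · obtain heR | heG := disjointSum_ground_eq ▸ mem_ground_of_mem_closure he
    · exact .inl ((mem_closure_disjointSum_iff h heR).1 he)
    · rw [disjointSum_comm] at he
      exact .inr ((mem_closure_disjointSum_iff h.symm heG).1 he)
  · rintro (he | he)
    · exact (mem_closure_disjointSum_iff h (mem_ground_of_mem_closure he)).2 he
    · rw [disjointSum_comm]
      exact (mem_closure_disjointSum_iff h.symm (mem_ground_of_mem_closure he)).2 he

lemma eRk_disjointSum (h : Disjoint R.E G.E) (hX : X ⊆ R.E) (hY : Y ⊆ G.E) :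
    (R.disjointSum G h).eRk (X ∪ Y) = R.eRk X + G.eRk Y := by
  obtain ⟨I, hI⟩ := R.exists_isBasis X
  obtain ⟨J, hJ⟩ := G.exists_isBasis Y
  have hinter {A B : Set α} (hA : A ⊆ R.E) (hB : B ⊆ G.E) :
      (A ∪ B) ∩ R.E = A ∧ (A ∪ B) ∩ G.E = B := by
    rw [union_inter_distrib_right, union_inter_distrib_right, inter_eq_self_of_subset_left hA,
      inter_eq_self_of_subset_left hB, (h.symm.mono_left hB).inter_eq, (h.mono_left hA).inter_eq,
      union_empty, empty_union]
    exact ⟨rfl, rfl⟩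
  obtain ⟨hIR, hJG⟩ := hinter hI.indep.subset_ground hJ.indep.subset_ground
  obtain ⟨hXR, hYG⟩ := hinter hX hY
  have hIJ : (R.disjointSum G h).IsBasis (I ∪ J) (X ∪ Y) := by
    rw [disjointSum_isBasis_iff, hIR, hJG, hXR, hYG]
    exact ⟨hI, hJ, union_subset_union hI.subset hJ.subset, union_subset_union hX hY⟩
  rw [← hIJ.encard_eq_eRk, ← hI.encard_eq_eRk, ← hJ.encard_eq_eRk,
    encard_union_eq (h.mono hI.indep.subset_ground hJ.indep.subset_ground)]

lemma disjointSum_delete_left {D : Set α} (h : Disjoint R.E G.E) (hD : Disjoint G.E D) :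
    (R.disjointSum G h) ＼ D = (R ＼ D).disjointSum G (h.mono_left sdiff_subset) := by
  refine ext_closure fun X ↦ ?_
  rw [delete_closure_eq, disjointSum_closure_eq, disjointSum_closure_eq, delete_closure_eq,
    union_sdiff_distrib]
  congr 1
  rw [← G.closure_inter_ground (X \ D), ← G.closure_inter_ground X, ← inter_sdiff_right_comm,
    (hD.mono_left inter_subset_right).sdiff_eq_left,
    (hD.mono_left (G.closure_subset_ground _)).sdiff_eq_left]

lemma disjointSum_contract_left {C : Set α} (h : Disjoint R.E G.E) (hC : C ⊆ R.E) :
    (R.disjointSum G h) ／ C = (R ／ C).disjointSum G (h.mono_left sdiff_subset) := by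
  refine ext_closure fun X ↦ ?_
  rw [contract_closure_eq, disjointSum_closure_eq, disjointSum_closure_eq, contract_closure_eq,
    union_sdiff_distrib]
  congr 1
  rw [← G.closure_inter_ground (X ∪ C), ← G.closure_inter_ground X, union_inter_distrib_right,
    (h.mono_left hC).inter_eq, union_empty,
    (h.symm.mono (G.closure_subset_ground _) hC).sdiff_eq_left]

end Rank

section Glue

variable {α : Type*} {R G U P P' : Matroid α} {A B C D I K X Y Y' : Set α} {e e' g g' x x' : α}

/-- In `R`, the elements `e` and `e'` are incomparable: `Y` spans `e` and not `e'`, while `Y'` spans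
`e'` and not `e`. -/
structure IsIncomparable (R : Matroid α) (e e' : α) (Y Y' : Set α) : Prop where
  mem : e ∈ R.closure Y
  notMem : e' ∉ R.closure Y
  mem' : e' ∈ R.closure Y'
  notMem' : e ∉ R.closure Y'

namespace IsIncomparable

lemma symm (h : IsIncomparable R e e' Y Y') : IsIncomparable R e' e Y' Y :=
  ⟨h.mem', h.notMem', h.mem, h.notMem⟩

lemma mem_ground (h : IsIncomparable R e e' Y Y') : e ∈ R.E := mem_ground_of_mem_closure h.mem

lemma notMem_closure_empty (h : IsIncomparable R e e' Y Y') : e ∉ R.closure ∅ :=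
  fun he ↦ h.notMem' (R.closure_subset_closure (empty_subset _) he)

lemma notMem_closure_singleton (h : IsIncomparable R e e' Y Y') : e' ∉ R.closure {e} := fun he' ↦
  h.notMem (R.closure_subset_closure_of_subset_closure (singleton_subset_iff.2 h.mem) he')

lemma ne (h : IsIncomparable R e e' Y Y') : e ≠ e' := by
  rintro rfl
  exact h.notMem h.mem

end IsIncomparable

/-- `U` is obtained from the direct sum of `R` and `G` by placing new points `x` and `x'` freely on
the lines spanned by `e, g` and by `e', g'`, and contracting both: this is the amalgam of `R` and
`G` that identifies `e` with `g` and `e'` with `g'`. -/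
structure IsGlue (R G : Matroid α) (e e' g g' : α) (U : Matroid α) : Prop where
  disjoint : Disjoint R.E G.E
  mem_left : e ∈ R.E
  mem_left' : e' ∈ R.E
  mem_right : g ∈ G.E
  mem_right' : g' ∈ G.E
  exists_isFreeExt : ∃ x x' P P', IsFreeExt (R.disjointSum G disjoint) {e, g} x P ∧
    IsFreeExt P {e', g'} x' P' ∧ U = P' ／ {x, x'}

lemma pair_subset_disjointSum (h : Disjoint R.E G.E) (he : e ∈ R.E) (hg : g ∈ G.E) :
    {e, g} ⊆ (R.disjointSum G h).E :=
  disjointSum_ground_eq ▸ pair_subset (.inl he) (.inr hg)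

lemma exists_isGlue [Infinite α] [R.Finite] [G.Finite] (h : Disjoint R.E G.E) (he : e ∈ R.E)
    (he' : e' ∈ R.E) (hg : g ∈ G.E) (hg' : g' ∈ G.E) : ∃ U, IsGlue R G e e' g g' U := by
  have hfin : (R.disjointSum G h).Finite :=
    ⟨disjointSum_ground_eq ▸ R.ground_finite.union G.ground_finite⟩
  obtain ⟨x, hx⟩ := (R.disjointSum G h).ground_finite.exists_notMem
  have hP := isFreeExt_freeExt (pair_subset_disjointSum h he hg) hx
  have := hP.finite
  obtain ⟨x', hx'⟩ := (freeExt (R.disjointSum G h) {e, g} x).ground_finite.exists_notMem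
  have hP' := isFreeExt_freeExt ((pair_subset_disjointSum h he' hg').trans hP.ground_subset) hx'
  exact ⟨_, h, he, he', hg, hg', x, x', _, _, hP, hP', rfl⟩

namespace IsGlue

lemma symm (h : IsGlue R G e e' g g' U) : IsGlue G R g g' e e' U := by
  obtain ⟨hd, he, he', hg, hg', x, x', P, P', hP, hP', rfl⟩ := h
  rw [disjointSum_comm, pair_comm] at hP
  rw [pair_comm] at hP'
  exact ⟨hd.symm, hg, hg', he, he', x, x', P, P', hP, hP', rfl⟩

lemma swap (h : IsGlue R G e e' g g' U) : IsGlue R G e' e g' g U := by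
  obtain ⟨hd, he, he', hg, hg', x, x', P, P', hP, hP', rfl⟩ := h
  have hF' := pair_subset_disjointSum hd he' hg'
  exact ⟨hd, he', he, hg', hg, x', x, P' ＼ {x}, P', hP.delete_left hP' hF', hP.comm hP' hF',
    by rw [pair_comm]⟩

lemma ground_eq (h : IsGlue R G e e' g g' U) : U.E = R.E ∪ G.E := by
  obtain ⟨hd, -, -, -, -, x, x', P, P', hP, hP', rfl⟩ := h
  have hx := hP.notMem
  have hx' := hP'.notMem
  rw [hP.ground_eq] at hx'
  rw [contract_ground, hP'.ground_eq, hP.ground_eq, ← disjointSum_ground_eq (h := hd)]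
  grind

lemma finite [R.Finite] [G.Finite] (h : IsGlue R G e e' g g' U) : U.Finite :=
  ⟨h.ground_eq ▸ R.ground_finite.union G.ground_finite⟩

lemma delete_left (h : IsGlue R G e e' g g' U) (hD : D ⊆ R.E \ {e, e'}) :
    IsGlue (R ＼ D) G e e' g g' (U ＼ D) := by
  obtain ⟨hd, he, he', hg, hg', x, x', P, P', hP, hP', rfl⟩ := h
  have hDG : Disjoint G.E D := hd.symm.mono_right (hD.trans sdiff_subset)
  have heD : e ∉ D := fun h ↦ (hD h).2 (by simp)
  have he'D : e' ∉ D := fun h ↦ (hD h).2 (by simp)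
  have hDS : D ⊆ (R.disjointSum G hd).E :=
    disjointSum_ground_eq ▸ (hD.trans sdiff_subset).trans subset_union_left
  have hxD : x ∉ D := fun h ↦ hP.notMem (hDS h)
  have hx'D : x' ∉ D := fun h ↦ hP'.notMem (hP.ground_subset (hDS h))
  have hQ := hP.delete hxD (by simp [heD, hDG.notMem_of_mem_left hg])
  rw [disjointSum_delete_left hd hDG] at hQ
  refine ⟨hd.mono_left sdiff_subset, ⟨he, heD⟩, ⟨he', he'D⟩, hg, hg', x, x', _, _, hQ,
    hP'.delete hx'D (by simp [he'D, hDG.notMem_of_mem_left hg']), ?_⟩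
  rw [contract_delete_comm _ (by simp [hxD, hx'D])]

lemma contract_left (h : IsGlue R G e e' g g' U) (hC : C ⊆ R.E \ {e, e'}) :
    IsGlue (R ／ C) G e e' g g' (U ／ C) := by
  obtain ⟨hd, he, he', hg, hg', x, x', P, P', hP, hP', rfl⟩ := h
  have hCR : C ⊆ R.E := hC.trans sdiff_subset
  have hCG : Disjoint G.E C := hd.symm.mono_right hCR
  have heC : e ∉ C := fun h ↦ (hC h).2 (by simp)
  have he'C : e' ∉ C := fun h ↦ (hC h).2 (by simp)
  have hCS : C ⊆ (R.disjointSum G hd).E :=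
    disjointSum_ground_eq ▸ hCR.trans subset_union_left
  have hQ := hP.contract hCS (by simp [heC, hCG.notMem_of_mem_left hg])
  rw [disjointSum_contract_left hd hCR] at hQ
  refine ⟨hd.mono_left sdiff_subset, ⟨he, heC⟩, ⟨he', he'C⟩, hg, hg', x, x', _, _, hQ,
    hP'.contract (hCS.trans hP.ground_subset) (by simp [he'C, hCG.notMem_of_mem_left hg']), ?_⟩
  rw [contract_comm]

lemma mem {α : Type u} {R G U : Matroid α} {e e' g g' : α} {𝓜 : MatroidClass.{u}}
    (h : IsGlue R G e e' g g' U) (hn : 𝓜.IsNatural) (hR : 𝓜.Mem R) (hG : 𝓜.Mem G) : 𝓜.Mem U := by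
  obtain ⟨hd, -, -, -, -, x, x', P, P', hP, hP', rfl⟩ := h
  exact hn.contract (hn.isFreeExt (hn.isFreeExt (hn.directSum _ _ _ hd hR hG) hP) hP') _

lemma mem_closure_singleton (h : IsGlue R G e e' g g' U) : e ∈ U.closure {g} := by
  have heU : e ∈ U.E := h.ground_eq ▸ .inl h.mem_left
  obtain ⟨hd, -, -, -, -, x, x', P, P', hP, hP', rfl⟩ := h
  have hgP : g ∈ P.E := hP.ground_subset (hP.subset_ground (by simp))
  have heP : e ∈ P.E := hP.ground_subset (hP.subset_ground (by simp))
  have hxg : e ∈ P'.closure {x, g} := by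
    rw [hP'.mem_closure_iff_of_mem (pair_subset hP.mem_ground hgP) heP]
    rw [pair_comm] at hP
    exact hP.mem_closure_pair
  rw [contract_closure_eq]
  exact ⟨P'.closure_subset_closure (by grind) hxg, heU.2⟩

end IsGlue

section Rank

lemma pair_subset_closure_disjointSum_iff (h : Disjoint R.E G.E) (he : e ∈ R.E) (hg : g ∈ G.E) :
    {e, g} ⊆ (R.disjointSum G h).closure X ↔ e ∈ R.closure X ∧ g ∈ G.closure X := by
  rw [pair_subset_iff, mem_closure_disjointSum_iff h he, disjointSum_comm,
    mem_closure_disjointSum_iff h.symm hg]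

variable {hd : Disjoint R.E G.E}

lemma IsFreeExt.mem_closure_disjointSum_iff (hP : IsFreeExt (R.disjointSum G hd) {e, g} x P)
    (he : e ∈ R.E) (hg : g ∈ G.E) (hX : X ⊆ R.E ∪ G.E) :
    x ∈ P.closure X ↔ e ∈ R.closure X ∧ g ∈ G.closure X := by
  rw [hP.mem_closure_iff X (disjointSum_ground_eq ▸ hX),
    pair_subset_closure_disjointSum_iff hd he hg]

lemma IsFreeExt.mem_closure_disjointSum_iff' (hP : IsFreeExt (R.disjointSum G hd) {e, g} x P)
    (hP' : IsFreeExt P {e', g'} x' P') (he' : e' ∈ R.E) (hg' : g' ∈ G.E) (hX : X ⊆ R.E ∪ G.E) :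
    x' ∈ P'.closure X ↔ e' ∈ R.closure X ∧ g' ∈ G.closure X := by
  have hXS : X ⊆ (R.disjointSum G hd).E := disjointSum_ground_eq ▸ hX
  rw [hP'.mem_closure_iff X (hXS.trans hP.ground_subset),
    hP.subset_closure_iff hXS (pair_subset_disjointSum hd he' hg'),
    pair_subset_closure_disjointSum_iff hd he' hg']

variable (hP : IsFreeExt (R.disjointSum G hd) {e, g} x P) (hP' : IsFreeExt P {e', g'} x' P')
  (he : e ∈ R.E)

include hP hP' he

lemma indep_union_of_isFreeExt_disjointSum (hG : IsIncomparable G g g' A B) (hI : R.Indep I) :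
    P'.Indep (I ∪ {x, x'}) := by
  have hg := hG.mem_ground
  have hg' := hG.symm.mem_ground
  have hIS : I ⊆ (R.disjointSum G hd).E :=
    disjointSum_ground_eq ▸ hI.subset_ground.trans subset_union_left
  have hIG : G.closure I = G.closure ∅ := by
    rw [← closure_inter_ground, (hd.mono_left hI.subset_ground).inter_eq]
  have hIP : P.Indep (insert x I) := by
    refine ((hP.indep_iff hIS).2 ?_).insert_indep_iff.2 (.inl ⟨hP.mem_ground, fun hx ↦ ?_⟩)
    · rw [disjointSum_indep_iff, inter_eq_self_of_subset_left hI.subset_ground,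
        (hd.mono_left hI.subset_ground).inter_eq, ← disjointSum_ground_eq (h := hd)]
      exact ⟨hI, G.empty_indep, hIS⟩
    · rw [hP.mem_closure_disjointSum_iff he hg (disjointSum_ground_eq ▸ hIS), hIG] at hx
      exact hG.notMem_closure_empty hx.2
  have hxx' : I ∪ {x, x'} = insert x' (insert x I) := by grind
  rw [hxx']
  refine ((hP'.indep_iff hIP.subset_ground).2 hIP).insert_indep_iff.2
    (.inl ⟨hP'.mem_ground, fun hx' ↦ ?_⟩)
  -- Otherwise `x` is spanned by `I + g'` by exchange with `g'`, and hence `g` is spanned by `g'`.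
  have hg'x : g' ∈ P.closure (insert x I) :=
    (hP'.mem_closure_iff _ hIP.subset_ground).1 hx' (by simp)
  have hg'I : g' ∉ P.closure I := by
    rw [hP.mem_closure_iff_of_mem hIS (disjointSum_ground_eq ▸ .inr hg'), disjointSum_comm,
      mem_closure_disjointSum_iff hd.symm hg', hIG]
    exact hG.symm.notMem_closure_empty
  have hxg' := (closure_exchange ⟨hg'x, hg'I⟩).1
  rw [hP.mem_closure_disjointSum_iff he hg (insert_subset (.inr hg')
    (disjointSum_ground_eq ▸ hIS)), G.closure_insert_congr_right hIG, insert_empty_eq] at hxg'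
  exact hG.symm.notMem_closure_singleton hxg'.2

lemma eRk_contract_add_two (hG : IsIncomparable G g g' A B) (hX : X ⊆ R.E ∪ G.E) :
    (P' ／ {x, x'}).eRk X + 2 = P'.eRk (X ∪ {x, x'}) := by
  have hind := indep_union_of_isFreeExt_disjointSum hP hP' he hG R.empty_indep
  rw [empty_union] at hind
  have hne : x ≠ x' := fun h ↦ hP'.notMem (h ▸ hP.mem_ground)
  have hXS : X ⊆ (R.disjointSum G hd).E := disjointSum_ground_eq ▸ hX
  rw [← eRk_contract_add_encard hind, encard_pair hne]
  refine subset_sdiff.2 ⟨hXS.trans (hP.ground_subset.trans hP'.ground_subset), ?_⟩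
  have hxX : x ∉ X := fun h ↦ hP.notMem (hXS h)
  have hx'X : x' ∉ X := fun h ↦ hP'.notMem (hP.ground_subset (hXS h))
  simp [hxX, hx'X]

end Rank

lemma closure_union_of_disjoint (hY : Disjoint Y R.E) : R.closure (X ∪ Y) = R.closure X := by
  rw [← R.closure_inter_ground (X ∪ Y), ← R.closure_inter_ground X, union_inter_distrib_right,
    hY.inter_eq, union_empty]

namespace IsGlue

lemma restrict_left (h : IsGlue R G e e' g g' U) (hG : IsIncomparable G g g' A B) :
    U ↾ R.E = R := by
  refine ext_indep rfl fun I hI ↦ ?_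
  rw [restrict_ground_eq] at hI
  rw [restrict_indep_iff, and_iff_left hI]
  obtain ⟨hd, he, -, -, -, x, x', P, P', hP, hP', rfl⟩ := h
  have hIS : I ⊆ (R.disjointSum G hd).E := disjointSum_ground_eq ▸ hI.trans subset_union_left
  have hind {I : Set α} (hI : R.Indep I) :=
    indep_union_of_isFreeExt_disjointSum hP hP' he hG hI
  have hxx' : P'.Indep {x, x'} := by simpa only [empty_union] using hind R.empty_indep
  refine ⟨fun h ↦ ?_, fun h ↦ hxx'.contract_indep_iff.2 ⟨?_, hind h⟩⟩
  · have h' := h.of_contract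
    rw [hP'.indep_iff (hIS.trans hP.ground_subset), hP.indep_iff hIS, disjointSum_indep_iff,
      inter_eq_self_of_subset_left hI] at h'
    exact h'.1
  · have hx : x ∉ I := fun h ↦ hP.notMem (hIS h)
    have hx' : x' ∉ I := fun h ↦ hP'.notMem (hP.ground_subset (hIS h))
    simp [hx, hx']

lemma restrict_right (h : IsGlue R G e e' g g' U) (hR : IsIncomparable R e e' Y Y') :
    U ↾ G.E = G :=
  h.symm.restrict_left hR

lemma eRk_union_add_one (h : IsGlue R G e e' g g' U) (hG : IsIncomparable G g g' A B) (hX : X ⊆ R.E)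
    (hK : K ⊆ G.E) (he : e ∈ R.closure X) (hg : g ∈ G.closure K)
    (h' : ¬ (e' ∈ R.closure X ∧ g' ∈ G.closure K)) :
    U.eRk (X ∪ K) + 1 = R.eRk X + G.eRk K := by
  obtain ⟨hd, heR, he'R, hgG, hg'G, x, x', P, P', hP, hP', rfl⟩ := h
  have hXK : X ∪ K ⊆ R.E ∪ G.E := union_subset_union hX hK
  have hXKS : X ∪ K ⊆ (R.disjointSum G hd).E := disjointSum_ground_eq ▸ hXK
  have hclR : R.closure (X ∪ K) = R.closure X := closure_union_of_disjoint (hd.symm.mono_left hK)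
  have hclG : G.closure (X ∪ K) = G.closure K :=
    union_comm X K ▸ closure_union_of_disjoint (hd.mono_left hX)
  have hx : x ∈ P'.closure (X ∪ K) := by
    rw [hP'.mem_closure_iff_of_mem (hXKS.trans hP.ground_subset) hP.mem_ground,
      hP.mem_closure_disjointSum_iff heR hgG hXK, hclR, hclG]
    exact ⟨he, hg⟩
  have hx' : x' ∉ P'.closure (X ∪ K) := by
    rwa [hP.mem_closure_disjointSum_iff' hP' he'R hg'G hXK, hclR, hclG]
  have hrk : (P' ／ {x, x'}).eRk (X ∪ K) + 1 + 1 = R.eRk X + G.eRk K + 1 := by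
    rw [add_assoc, one_add_one_eq_two, eRk_contract_add_two hP hP' heR hG hXK,
      show X ∪ K ∪ {x, x'} = insert x' (insert x (X ∪ K)) by grind, ← eRk_closure_eq,
      closure_insert_congr_right (closure_insert_eq_of_mem_closure hx), eRk_closure_eq,
      eRk_insert_eq_add_one ⟨hP'.mem_ground, hx'⟩, hP'.eRk_eq (hXKS.trans hP.ground_subset),
      hP.eRk_eq hXKS, eRk_disjointSum hd hX hK]
  exact WithTop.add_right_cancel ENat.one_ne_top hrk

lemma eRk_union_add_two (h : IsGlue R G e e' g g' U) (hG : IsIncomparable G g g' A B) (hX : X ⊆ R.E)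
    (hK : K ⊆ G.E) (he : e ∈ R.closure X) (hg : g ∈ G.closure K) (he' : e' ∈ R.closure X)
    (hg' : g' ∈ G.closure K) : U.eRk (X ∪ K) + 2 = R.eRk X + G.eRk K := by
  obtain ⟨hd, heR, he'R, hgG, hg'G, x, x', P, P', hP, hP', rfl⟩ := h
  have hXK : X ∪ K ⊆ R.E ∪ G.E := union_subset_union hX hK
  have hXKS : X ∪ K ⊆ (R.disjointSum G hd).E := disjointSum_ground_eq ▸ hXK
  have hclR : R.closure (X ∪ K) = R.closure X := closure_union_of_disjoint (hd.symm.mono_left hK)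
  have hclG : G.closure (X ∪ K) = G.closure K :=
    union_comm X K ▸ closure_union_of_disjoint (hd.mono_left hX)
  have hx : x ∈ P'.closure (X ∪ K) := by
    rw [hP'.mem_closure_iff_of_mem (hXKS.trans hP.ground_subset) hP.mem_ground,
      hP.mem_closure_disjointSum_iff heR hgG hXK, hclR, hclG]
    exact ⟨he, hg⟩
  have hx' : x' ∈ P'.closure (X ∪ K) := by
    rw [hP.mem_closure_disjointSum_iff' hP' he'R hg'G hXK, hclR, hclG]
    exact ⟨he', hg'⟩
  rw [eRk_contract_add_two hP hP' heR hG hXK, ← eRk_closure_eq,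
    ← closure_union_closure_left_eq, union_eq_self_of_subset_right (pair_subset hx hx'),
    closure_closure, eRk_closure_eq,
    hP'.eRk_eq (hXKS.trans hP.ground_subset), hP.eRk_eq hXKS, eRk_disjointSum hd hX hK]

end IsGlue

end Glue

section Pinned

variable {α : Type*} {M R G U : Matroid α} {A B K Q S T X Y Y' : Set α} {e e' g g' : α}

lemma restrict_insert_delete (M : Matroid α) (he : e ∉ X) : (M ↾ insert e X) ＼ {e} = M ↾ X := by
  rw [delete_eq_restrict, restrict_ground_eq, insert_sdiff_self_of_notMem he,
    restrict_restrict_eq _ (subset_insert _ _)]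

lemma localConn_restrict (hS : S ⊆ X) (hT : T ⊆ X) :
    (M ↾ X).localConn S T = M.localConn S T := by
  simp only [localConn, rankOf, restrict_eRk_eq _ hS, restrict_eRk_eq _ hT,
    restrict_eRk_eq _ (union_subset hS hT)]

namespace IsGlue

lemma rankOf_left (h : IsGlue R G e e' g g' U) (hG : IsIncomparable G g g' A B) (hX : X ⊆ R.E) :
    U.rankOf X = R.rankOf X := by
  rw [rankOf, rankOf, ← h.restrict_left hG, restrict_eRk_eq _ hX]

lemma mem_closure_iff_left (h : IsGlue R G e e' g g' U) (hG : IsIncomparable G g g' A B)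
    (hX : X ⊆ R.E) {f : α} (hf : f ∈ R.E) : f ∈ U.closure X ↔ f ∈ R.closure X := by
  rw [← h.restrict_left hG, restrict_closure_eq _ hX (h.ground_eq ▸ subset_union_left),
    mem_inter_iff, and_iff_left hf]

lemma isNonloop_left (h : IsGlue R G e e' g g' U) (hR : IsIncomparable R e e' Y Y')
    (hG : IsIncomparable G g g' A B) : U.IsNonloop e := by
  have heU : e ∈ U.E := h.ground_eq ▸ .inl hR.mem_ground
  rw [isNonloop_iff_notMem_loops, loops, h.mem_closure_iff_left hG (empty_subset _) hR.mem_ground]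
  exact hR.notMem_closure_empty

lemma mem_closure_of_mem_right (h : IsGlue R G e e' g g' U) (hR : IsIncomparable R e e' Y Y')
    (hX : X ⊆ G.E) (hg : g ∈ G.closure X) : e ∈ U.closure X :=
  U.closure_subset_closure_of_subset_closure (singleton_subset_iff.2
    ((h.symm.mem_closure_iff_left hR hX (mem_ground_of_mem_closure hg)).2 hg))
    h.mem_closure_singleton

variable [R.Finite] [G.Finite]

lemma localConn_eq_one (h : IsGlue R G e e' g g' U) (hR : IsIncomparable R e e' Y Y')
    (hG : IsIncomparable G g g' A B) (hX : X ⊆ R.E) (hK : K ⊆ G.E) (he : e ∈ R.closure X)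
    (hg : g ∈ G.closure K) (h' : ¬ (e' ∈ R.closure X ∧ g' ∈ G.closure K)) :
    U.localConn X K = 1 := by
  have := h.finite
  have hrk := h.eRk_union_add_one hG hX hK he hg h'
  simp only [← coe_rankOf] at hrk
  rw [localConn, h.rankOf_left hG hX, h.symm.rankOf_left hR hK]
  norm_cast at hrk
  omega

lemma localConn_eq_two (h : IsGlue R G e e' g g' U) (hR : IsIncomparable R e e' Y Y')
    (hG : IsIncomparable G g g' A B) (hX : X ⊆ R.E) (hK : K ⊆ G.E) (he : e ∈ R.closure X)
    (hg : g ∈ G.closure K) (he' : e' ∈ R.closure X) (hg' : g' ∈ G.closure K) :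
    U.localConn X K = 2 := by
  have := h.finite
  have hrk := h.eRk_union_add_two hG hX hK he hg he' hg'
  simp only [← coe_rankOf] at hrk
  rw [localConn, h.rankOf_left hG hX, h.symm.rankOf_left hR hK]
  norm_cast at hrk
  omega

lemma isPinnedExtension (h : IsGlue R G e e' g g' U) (hR : IsIncomparable R e e' Y Y')
    (hG : IsIncomparable G g g' A B) (hQ : Q ⊆ R.E) (heQ : e ∉ Q) (hY : Y ⊆ Q) (hY' : Y' ⊆ Q)
    (hQ₃ : 3 ≤ Q.encard) (hK : K ⊆ G.E) (hA : A ⊆ K) (hB : B ⊆ K) (hK₃ : 3 ≤ K.encard) :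
    (U ↾ insert e (Q ∪ K)).IsPinnedExtension e := by
  have heQK : e ∉ Q ∪ K := fun he ↦
    he.elim heQ fun he ↦ h.disjoint.notMem_of_mem_left hR.mem_ground (hK he)
  have hWU : insert e (Q ∪ K) ⊆ U.E :=
    h.ground_eq ▸ insert_subset (.inl hR.mem_ground) (union_subset_union hQ hK)
  have heQcl : e ∈ R.closure Q := R.closure_subset_closure hY hR.mem
  have he'Qcl : e' ∈ R.closure Q := R.closure_subset_closure hY' hR.mem'
  have hgKcl : g ∈ G.closure K := G.closure_subset_closure hA hG.mem
  have hg'Kcl : g' ∈ G.closure K := G.closure_subset_closure hB hG.mem'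
  have heY : e ∈ U.closure Y := (h.mem_closure_iff_left hG (hY.trans hQ) hR.mem_ground).2 hR.mem
  have heA : e ∈ U.closure A := h.mem_closure_of_mem_right hR (hA.trans hK) hG.mem
  have hrestr {X : Set α} (hX : X ⊆ Q ∪ K) (he : e ∈ U.closure X) :
      e ∈ (U ↾ insert e (Q ∪ K)).closure X := by
    rw [restrict_closure_eq _ (hX.trans (subset_insert _ _)) hWU]
    exact ⟨he, mem_insert _ _⟩
  rw [IsPinnedExtension, restrict_insert_delete _ heQK]
  refine ⟨restrict_isNonloop_iff.2 ⟨h.isNonloop_left hR hG, mem_insert _ _⟩, Q, K, Y, A,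
    ⟨rfl, h.disjoint.mono hQ hK, hQ₃, hK₃, ?_⟩, hY, hA, ?_, ?_,
    hrestr (hY.trans subset_union_left) heY, hrestr (hA.trans subset_union_right) heA⟩
  · rw [localConn_restrict subset_union_left subset_union_right,
      h.localConn_eq_two hR hG hQ hK heQcl hgKcl he'Qcl hg'Kcl]
    norm_num
  · rw [localConn_restrict (hY.trans subset_union_left) subset_union_right]
    exact h.localConn_eq_one hR hG (hY.trans hQ) hK hR.mem hgKcl fun hh ↦ hR.notMem hh.1
  · rw [localConn_restrict subset_union_left (hA.trans subset_union_right)]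
    exact h.localConn_eq_one hR hG hQ (hA.trans hK) heQcl hG.mem fun hh ↦ hG.notMem hh.2

end IsGlue

end Pinned

/-- In `H`, the element `g` is freer than `g'`: every set avoiding both that spans `g` also spans
`g'`. -/
def IsFreer {α : Type*} (H : Matroid α) (g g' : α) : Prop :=
  ∀ X ⊆ H.E \ {g, g'}, g ∈ H.closure X → g' ∈ H.closure X

lemma IsFreeExt.pair_subset_closure_iff {α : Type*} {R G P : Matroid α} {X : Set α}
    {e e' g g' p x' : α} {hd : Disjoint R.E G.E}
    (hP : IsFreeExt (R.disjointSum G hd) {e', g'} x' P) (he' : e' ∈ R.E) (hg : g ∈ G.E)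
    (hg' : g' ∈ G.E) (hp : p ∈ R.closure {e, e'}) (hep : e ∈ R.closure {p, e'})
    (hX : X ⊆ R.E ∪ G.E) (hfree : g ∈ G.closure X → g' ∈ G.closure X) :
    {e, g} ⊆ P.closure (insert x' X) ↔ {p, g, g'} ⊆ P.closure (insert x' X) := by
  set W := P.closure (insert x' X)
  have hXS : X ⊆ (R.disjointSum G hd).E := disjointSum_ground_eq ▸ hX
  have hx'W : x' ∈ W := P.subset_closure _ (insert_subset hP.mem_ground
    (hXS.trans hP.ground_subset)) (mem_insert _ _)
  have hspan {a b c : α} (hc : c ∈ P.closure {a, b}) (ha : a ∈ W) (hb : b ∈ W) : c ∈ W :=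
    P.closure_subset_closure_of_subset_closure (pair_subset ha hb) hc
  have hRP (Z) : R.closure Z ⊆ P.closure Z := fun z hz ↦
    hP.closure_subset Z (disjointSum_closure_eq hd Z ▸ .inl hz)
  have he'g' : e' ∈ W → g' ∈ W := hspan hP.mem_closure_pair hx'W
  have hg'e' : g' ∈ W → e' ∈ W := hspan (pair_comm e' g' ▸ hP).mem_closure_pair hx'W
  simp only [insert_subset_iff, singleton_subset_iff]
  refine ⟨fun ⟨he, hgW⟩ ↦ ?_, fun ⟨hpW, hgW, hg'W⟩ ↦ ⟨hspan (hRP _ hep) hpW (hg'e' hg'W), hgW⟩⟩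
  suffices hg'W : g' ∈ W from ⟨hspan (hRP _ hp) he (hg'e' hg'W), hgW, hg'W⟩
  have hGX {y : α} (hy : y ∈ G.E) : y ∈ P.closure X ↔ y ∈ G.closure X := by
    rw [hP.mem_closure_iff_of_mem hXS (disjointSum_ground_eq ▸ .inr hy), disjointSum_comm,
      _root_.mem_closure_disjointSum_iff hd.symm hy]
  by_cases hgX : g ∈ P.closure X
  · exact P.closure_subset_closure (subset_insert _ _) ((hGX hg').2 (hfree ((hGX hg).1 hgX)))
  · have hx' := (closure_exchange ⟨hgW, hgX⟩).1
    rw [hP.mem_closure_disjointSum_iff he' hg' (insert_subset (.inr hg) hX), insert_eq,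
      union_comm, closure_union_of_disjoint
        (disjoint_singleton_left.2 (hd.notMem_of_mem_right hg))] at hx'
    exact he'g' (P.closure_subset_closure (subset_insert _ _) (hRP _ hx'.1))

lemma IsFreeExt.pair_subset_closure_contract_iff {α : Type*} {R G P : Matroid α} {X : Set α}
    {e e' g g' p x' : α} {hd : Disjoint R.E G.E}
    (hP : IsFreeExt (R.disjointSum G hd) {e', g'} x' P) (he : e ∈ R.E) (he' : e' ∈ R.E)
    (hg : g ∈ G.E) (hg' : g' ∈ G.E) (hp : p ∈ R.closure {e, e'}) (hep : e ∈ R.closure {p, e'})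
    (hX : X ⊆ R.E ∪ G.E) (hfree : g ∈ G.closure X → g' ∈ G.closure X) :
    {e, g} ⊆ (P ／ {x'}).closure X ↔ {p, g, g'} ⊆ (P ／ {x'}).closure X := by
  have hx' : x' ∉ R.E ∪ G.E :=
    (disjointSum_ground_eq : (R.disjointSum G hd).E = _) ▸ hP.notMem
  have hpR : p ∈ R.E := mem_ground_of_mem_closure hp
  rw [contract_closure_eq, union_singleton, subset_sdiff, subset_sdiff,
    hP.pair_subset_closure_iff he' hg hg' hp hep hX hfree, and_iff_left, and_iff_left]
  all_goals grind

/-- If `g` is freer than `g'` in `G`, then the glued matroid without `e`, `e'`, `g` and `g'` can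
be built without `e`: instead of identifying `e` with `g`, identify `p` with a point placed
freely on the line through `g` and `g'`. -/
lemma IsGlue.mem_of_isFreer {α : Type u} {𝓜 : MatroidClass.{u}} {R G U : Matroid α}
    {e e' g g' p : α} (h : IsGlue R G e e' g g' U) (hn : 𝓜.IsNatural) (hR : 𝓜.Mem (R ＼ {e}))
    (hG : 𝓜.Mem G) (hee' : e ≠ e') (hpe : p ≠ e) (hp : p ∈ R.closure {e, e'})
    (hep : e ∈ R.closure {p, e'}) (hfree : IsFreer G g g') :
    𝓜.Mem (U ＼ ({e, e'} ∪ {g, g'})) := by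
  obtain ⟨hd, he', he, hg', hg, x', x, P, P', hP, hP', rfl⟩ := h.swap
  have hpR : p ∈ R.E := mem_ground_of_mem_closure hp
  have hSE : (R.disjointSum G hd).E = R.E ∪ G.E := disjointSum_ground_eq
  have hRP : R.E ⊆ P.E := (hSE ▸ subset_union_left).trans hP.ground_subset
  have hGP : G.E ⊆ P.E := (hSE ▸ subset_union_right).trans hP.ground_subset
  have hx' : x' ∉ R.E ∪ G.E := hSE ▸ hP.notMem
  have hx : x ∉ P.E := hP'.notMem
  have heG : e ∉ G.E := hd.notMem_of_mem_left he
  have hT : 𝓜.Mem ((P ／ {x'}) ＼ {e}) := by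
    have hP₀ := hP.delete (D := {e}) (by grind) (by simp; grind)
    rw [disjointSum_delete_left hd (by simpa)] at hP₀
    rw [contract_delete_comm _ (by simp; grind)]
    exact hn.contract (hn.isFreeExt (hn.directSum _ _ _ _ hR hG) hP₀) _
  have hV : IsFreeExt (P ／ {x'}) {e, g} x (P' ／ {x'}) :=
    hP'.contract (by simpa using hP.mem_ground) (by simp; grind)
  suffices h𝓜 : 𝓜.Mem ((P' ／ {x'}) ＼ ({e, e'} ∪ {g, g'})) by
    rw [← singleton_union, ← contract_contract, contract_delete_comm _ (by simp; grind)]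
    exact hn.contract h𝓜 _
  refine hn.of_mem_closure_iff (F := {p, g, g'}) (D := {e, e'} ∪ {g, g'}) (e := x) hT ?_ ?_ ?_ ?_ ?_
    fun X hX ↦ ?_
  · simp only [delete_ground, contract_ground]; grind
  · exact ⟨hV.mem_ground, by grind⟩
  · exact fun h ↦ hx h.1.1
  · grind
  · rw [delete_comm, hV.delete_eq, delete_delete]
    congr 1; grind
  · obtain ⟨hXRG, hXD⟩ : X ⊆ R.E ∪ G.E ∧ Disjoint X ({e, e'} ∪ {g, g'}) := by
      have hE : (P' ／ {x'}).E = insert x (insert x' (R.E ∪ G.E) \ {x'}) := by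
        rw [hV.ground_eq, contract_ground, hP.ground_eq, hSE]
      simp only [delete_ground, hE] at hX
      grind
    have hXe : Disjoint X {e} := hXD.mono_right (by simp)
    have hxD : x ∉ ({e, e'} ∪ {g, g'} : Set α) := by grind
    have hFe : Disjoint {p, g, g'} ({e} : Set α) := by simp; grind
    have hfreeX : g ∈ G.closure X → g' ∈ G.closure X := by
      simpa only [closure_inter_ground] using hfree (X ∩ G.E) (by grind)
    have hXV : X ⊆ (P ／ {x'}).E := by
      rw [contract_ground, hP.ground_eq, hSE]
      grind
    rw [delete_closure_eq_of_disjoint _ hXD, mem_sdiff, and_iff_left hxD, hV.mem_closure_iff _ hXV,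
      hP.pair_subset_closure_contract_iff he he' hg hg' hp hep hXRG hfreeX,
      delete_closure_eq_of_disjoint _ hXe, subset_sdiff, and_iff_left hFe]

namespace MatroidClass

variable {α : Type u} {𝓜 : MatroidClass.{u}} {M : Matroid α} {K : Set α}

lemma exists_isExcludedMinor [hM : M.Finite] (h : ¬ 𝓜.Mem M) :
    ∃ L, L ≤m M ∧ 𝓜.IsExcludedMinor L := by
  induction hn : M.E.ncard using Nat.strong_induction_on generalizing M with
  | _ n ih =>
  by_cases hall : ∀ N : Matroid α, N <m M → 𝓜.Mem N
  · exact ⟨M, IsMinor.refl, hM, h, hall⟩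
  push Not at hall
  obtain ⟨N, hNM, hN⟩ := hall
  have : N.Finite := ⟨hM.ground_finite.subset hNM.ssubset.subset⟩
  obtain ⟨L, hL, hL'⟩ := ih N.E.ncard (hn ▸ ncard_lt_ncard hNM.ssubset hM.ground_finite) hN rfl
  exact ⟨L, hL.trans hNM.isMinor, hL'⟩

lemma exists_isExcludedMinor_restrict_isMinor [M.Finite] (hn : 𝓜.IsNatural) (h : ¬ 𝓜.Mem M)
    (hK : K ⊆ M.E) (hcon : ∀ f ∈ M.E, 𝓜.Mem (M ／ {f})) (hdel : ∀ f ∈ K, 𝓜.Mem (M ＼ {f})) :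
    ∃ L, L ≤m M ∧ 𝓜.IsExcludedMinor L ∧ M ↾ K ≤m L := by
  obtain ⟨L, hLM, hL⟩ := exists_isExcludedMinor h
  refine ⟨L, hLM, hL, ?_⟩
  obtain ⟨C, D, hC, -, -, rfl⟩ := hLM.exists_eq_contract_delete_disjoint
  obtain rfl : C = ∅ := by
    by_contra! ⟨f, hf⟩
    refine hL.2.1 (hn.delete ?_ D)
    rw [← union_eq_self_of_subset_left (singleton_subset_iff.2 hf), ← contract_contract]
    exact hn.contract (hcon f (hC hf)) C
  rw [contract_empty] at hL ⊢
  have hKD : Disjoint K D := by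
    refine disjoint_left.2 fun f hfK hfD ↦ hL.2.1 ?_
    rw [← union_eq_self_of_subset_left (singleton_subset_iff.2 hfD), ← delete_delete]
    exact hn.delete (hdel f hfK) D
  have hKMD : K ⊆ M.E \ D := subset_sdiff.2 ⟨hK, hKD⟩
  exact ⟨∅, (M ＼ D).E \ K, by
    rw [contract_empty, delete_compl hKMD, delete_eq_restrict, restrict_restrict_eq M hKMD]⟩

end MatroidClass

/-- `G` consists of `A ∪ B` together with two incomparable points `g` and `g'`, and deleting or
contracting any element of `A ∪ B` makes one of `g` and `g'` freer than the other. -/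
structure IsGadget {α : Type*} (G : Matroid α) (g g' : α) (A B : Set α) : Prop where
  side : IsIncomparable G g g' A B
  union_eq : A ∪ B = G.E \ {g, g'}
  three_le : 3 ≤ (A ∪ B).encard
  freer_delete : ∀ f ∈ A ∪ B, IsFreer (G ＼ {f}) g g' ∨ IsFreer (G ＼ {f}) g' g
  freer_contract : ∀ f ∈ A ∪ B, IsFreer (G ／ {f}) g g' ∨ IsFreer (G ／ {f}) g' g

/-- `R` is not in the class, but all single-element deletions and contractions are, except possibly
for the deletion of a third point `p` of the line through two incomparable points `e` and `e'` and
the contraction of `e` or `e'`. -/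
structure IsObstruction {α : Type u} (𝓜 : MatroidClass.{u}) (R : Matroid α) (e e' p : α)
    (Y Y' : Set α) : Prop where
  side : IsIncomparable R e e' Y Y'
  subset : Y ⊆ R.E \ {e, e'}
  subset' : Y' ⊆ R.E \ {e, e'}
  mem : p ∈ R.E \ {e, e'}
  mem_closure : p ∈ R.closure {e, e'}
  mem_closure_left : e ∈ R.closure {p, e'}
  mem_closure_right : e' ∈ R.closure {p, e}
  three_le : 3 ≤ (R.E \ {e, e'}).encard
  notMem : ¬ 𝓜.Mem R
  mem_delete : ∀ f ∈ R.E, f ≠ p → 𝓜.Mem (R ＼ {f})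
  mem_contract : ∀ f ∈ R.E \ {e, e'}, 𝓜.Mem (R ／ {f})

namespace IsObstruction

variable {α : Type u} {𝓜 𝓜₁ 𝓜₂ : MatroidClass.{u}} {R G H U : Matroid α} {A B Y Y' : Set α}
  {e e' f g g' p : α}

lemma glue_mem (hR : IsObstruction 𝓜 R e e' p Y Y') (h : IsGlue R H e e' g g' U)
    (hn : 𝓜.IsNatural) (hH : 𝓜.Mem H) (hfree : IsFreer H g g' ∨ IsFreer H g' g) :
    𝓜.Mem (U ＼ ({e, e'} ∪ {g, g'})) := by
  have hpe : p ≠ e := fun h ↦ hR.mem.2 (by simp [h])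
  have hpe' : p ≠ e' := fun h ↦ hR.mem.2 (by simp [h])
  obtain hfree | hfree := hfree
  · exact h.mem_of_isFreer hn (hR.mem_delete e h.mem_left hpe.symm) hH hR.side.ne hpe
      hR.mem_closure hR.mem_closure_left hfree
  · rw [pair_comm e, pair_comm g]
    exact h.swap.mem_of_isFreer hn (hR.mem_delete e' h.mem_left' hpe'.symm) hH hR.side.ne.symm hpe'
      (pair_comm e e' ▸ hR.mem_closure) hR.mem_closure_right hfree

/-- Adding back `e` and then `e'` is a pinned extension each time, and leads to a matroid
that has `R` as a restriction. -/
lemma glue_notMem [R.Finite] [G.Finite] (hR : IsObstruction 𝓜 R e e' p Y Y')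
    (hG : IsGadget G g g' A B) (h : IsGlue R G e e' g g' U) (hn : 𝓜.IsNatural)
    (hpin : 𝓜.ClosedUnderPinnedExtensions) : ¬ 𝓜.Mem (U ↾ (R.E \ {e, e'} ∪ (A ∪ B))) := by
  intro hmem
  have hKG : A ∪ B ⊆ G.E := hG.union_eq ▸ sdiff_subset
  set Q := R.E \ {e, e'} with hQ
  set K := A ∪ B
  have heQK : e ∉ Q ∪ K := by grind [h.disjoint.notMem_of_mem_left h.mem_left]
  have he'QK : e' ∉ insert e Q ∪ K := by
    grind [h.disjoint.notMem_of_mem_left h.mem_left', hR.side.ne]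
  have hpin_e := h.isPinnedExtension hR.side hG.side (Q := Q) sdiff_subset (by simp [Q]) hR.subset
    hR.subset' hR.three_le hKG subset_union_left subset_union_right hG.three_le
  have hpin_e' := h.swap.isPinnedExtension hR.side.symm hG.side.symm (Q := insert e Q)
    (insert_subset h.mem_left sdiff_subset) (fun h ↦ he'QK (.inl h))
    (hR.subset'.trans (subset_insert _ _)) (hR.subset.trans (subset_insert _ _))
    (hR.three_le.trans (encard_le_encard (subset_insert _ _))) hKG subset_union_right
    subset_union_left hG.three_le
  have hmem_e : 𝓜.Mem (U ↾ insert e (Q ∪ K)) :=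
    hpin _ _ e (by rwa [restrict_insert_delete _ heQK]) hpin_e
  have hmem_e' : 𝓜.Mem (U ↾ insert e' (insert e Q ∪ K)) :=
    hpin _ _ e' (by rwa [restrict_insert_delete _ he'QK, insert_union]) hpin_e'
  have hRQK : R.E ⊆ insert e' (insert e Q ∪ K) :=
    fun x hx ↦ by simp only [hQ, mem_insert_iff, mem_union, mem_sdiff]; tauto
  have hmem_R := hn.restrict hmem_e' hRQK
  rw [restrict_restrict_eq _ hRQK, h.restrict_left hG.side] at hmem_R
  exact hR.notMem hmem_R

lemma glue_mem_delete (hR : IsObstruction 𝓜 R e e' p Y Y') (hG : IsGadget G g g' A B)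
    (h : IsGlue R G e e' g g' U) (hn : 𝓜.IsNatural) (hG𝓜 : 𝓜.Mem G)
    (hf : f ∈ R.E \ {e, e'} ∪ (A ∪ B)) (hfp : f ≠ p) :
    𝓜.Mem ((U ＼ ({e, e'} ∪ {g, g'})) ＼ {f}) := by
  rw [delete_comm]
  obtain hf | hf := hf
  · exact hn.delete ((h.delete_left (singleton_subset_iff.2 hf)).mem hn
      (hR.mem_delete f hf.1 hfp) hG𝓜) _
  · have hGf := (h.symm.delete_left (singleton_subset_iff.2 (hG.union_eq ▸ hf))).symm
    exact hR.glue_mem hGf hn (hn.delete hG𝓜 _) (hG.freer_delete f hf)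

lemma glue_mem_contract (hR : IsObstruction 𝓜 R e e' p Y Y') (hG : IsGadget G g g' A B)
    (h : IsGlue R G e e' g g' U) (hn : 𝓜.IsNatural) (hG𝓜 : 𝓜.Mem G)
    (hf : f ∈ R.E \ {e, e'} ∪ (A ∪ B)) :
    𝓜.Mem ((U ＼ ({e, e'} ∪ {g, g'})) ／ {f}) := by
  have hfD : Disjoint ({f} : Set α) ({e, e'} ∪ {g, g'}) := by
    rw [hG.union_eq] at hf
    grind [h.disjoint, h.mem_left, h.mem_left', h.mem_right, h.mem_right']
  rw [← contract_delete_comm _ hfD]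
  obtain hf | hf := hf
  · exact hn.delete ((h.contract_left (singleton_subset_iff.2 hf)).mem hn
      (hR.mem_contract f hf) hG𝓜) _
  · have hGf := (h.symm.contract_left (singleton_subset_iff.2 (hG.union_eq ▸ hf))).symm
    exact hR.glue_mem hGf hn (hn.contract hG𝓜 _) (hG.freer_contract f hf)

lemma exists_isExcludedMinor [R.Finite] [Infinite α] (hR : IsObstruction 𝓜₁ R e e' p Y Y')
    (hG : IsGadget G g g' A B) (hd : Disjoint R.E G.E) (hn₁ : 𝓜₁.IsNatural) (hn₂ : 𝓜₂.IsNatural)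
    (hpin : 𝓜₁.ClosedUnderPinnedExtensions) (hR₂ : 𝓜₂.Mem R) (hG₁ : 𝓜₁.Mem G) (hG₂ : 𝓜₂.Mem G) :
    ∃ L, 𝓜₁.IsExcludedMinor L ∧ 𝓜₂.Mem L ∧ G ↾ (A ∪ B) ≤m L := by
  have := 𝓜₂.finite_of_mem _ hG₂
  obtain ⟨U, h⟩ := exists_isGlue hd hR.side.mem_ground hR.side.symm.mem_ground hG.side.mem_ground
    hG.side.symm.mem_ground
  have := h.finite
  have hKG : A ∪ B ⊆ G.E := hG.union_eq ▸ sdiff_subset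
  set M := U ＼ ({e, e'} ∪ {g, g'}) with hMdef
  have hME : M.E = R.E \ {e, e'} ∪ (A ∪ B) := by
    rw [hMdef, delete_ground, h.ground_eq, hG.union_eq]
    grind [h.disjoint, h.mem_left, h.mem_left', h.mem_right, h.mem_right']
  have hKM : A ∪ B ⊆ M.E := hME ▸ subset_union_right
  have hMU : M = U ↾ (R.E \ {e, e'} ∪ (A ∪ B)) := by rw [← hME, hMdef, delete_eq_restrict]; rfl
  have hM₂ : 𝓜₂.Mem M := hn₂.delete (h.mem hn₂ hR₂ hG₂) _
  obtain ⟨L, hLM, hL, hKL⟩ := MatroidClass.exists_isExcludedMinor_restrict_isMinor hn₁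
    (hMU ▸ hR.glue_notMem hG h hn₁ hpin) hKM
    (fun f hf ↦ hR.glue_mem_contract hG h hn₁ hG₁ (hME ▸ hf)) fun f hf ↦
    hR.glue_mem_delete hG h hn₁ hG₁ (.inr hf) fun hfp ↦
      h.disjoint.notMem_of_mem_left hR.mem.1 (hfp ▸ hKG hf)
  refine ⟨L, hL, hn₂.minor _ _ _ hM₂ hLM, ?_⟩
  rwa [hMU, restrict_restrict_eq _ (hME ▸ hKM), ← restrict_restrict_eq U hKG,
    h.restrict_right hR.side] at hKL

end IsObstruction

section Freer

variable {α : Type*} {M : Matroid α} {e f g : α}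

lemma isFreer_refl (M : Matroid α) (e : α) : IsFreer M e e := fun _ _ h ↦ h

lemma IsFreer.trans (h : IsFreer M e f) (h' : IsFreer M f g) : IsFreer M e g := by
  intro X hX heX
  obtain rfl | hge := eq_or_ne g e
  · exact heX
  by_cases hfX : f ∈ X
  · by_cases heX' : e ∈ M.closure (X \ {f})
    · have hfX' := h _ (by grind) heX'
      exact M.closure_subset_closure sdiff_subset (h' _ (by grind) hfX')
    · have hX' : insert f (X \ {f}) = X := insert_sdiff_self_of_mem hfX
      have hf := (closure_exchange ⟨hX'.symm ▸ heX, heX'⟩).1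
      rw [← closure_insert_eq_of_mem_closure heX]
      exact M.closure_subset_closure (insert_subset_insert sdiff_subset)
        (h' _ (by grind [mem_ground_of_mem_closure heX]) hf)
  · exact h' X (by grind) (h X (by grind) heX)

lemma exists_forall_isFreer [M.Finite] (hne : M.E.Nonempty)
    (h : ∀ e ∈ M.E, ∀ f ∈ M.E, IsFreer M e f ∨ IsFreer M f e) :
    ∃ e ∈ M.E, ∀ f ∈ M.E, IsFreer M e f := by
  obtain ⟨e, he, hmax⟩ := exists_max_image M.E (fun e ↦ {f ∈ M.E | IsFreer M e f}.ncard)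
    M.ground_finite hne
  refine ⟨e, he, fun f hf ↦ by_contra fun hef ↦ ?_⟩
  have hfe := (h e he f hf).resolve_left hef
  refine (hmax f hf).not_gt (ncard_lt_ncard ?_ (M.ground_finite.subset (sep_subset _ _)))
  exact ⟨fun x hx ↦ ⟨hx.1, hfe.trans hx.2⟩, fun hss ↦ hef (hss ⟨hf, isFreer_refl M f⟩).2⟩

lemma exists_isIncomparable_of_not_isFreer (h : ¬ IsFreer M e f) (h' : ¬ IsFreer M f e) :
    ∃ Y Y', Y ⊆ M.E \ {e, f} ∧ Y' ⊆ M.E \ {e, f} ∧ IsIncomparable M e f Y Y' := by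
  simp only [IsFreer, not_forall] at h h'
  obtain ⟨Y, hY, heY, hfY⟩ := h
  obtain ⟨Y', hY', hfY', heY'⟩ := h'
  exact ⟨Y, Y', hY, pair_comm f e ▸ hY', heY, hfY, hfY', heY'⟩

lemma MatroidClass.IsNatural.mem_of_forall_isFreer {α : Type u} {𝓜 : MatroidClass.{u}}
    {M : Matroid α} {e : α} (h : 𝓜.IsNatural) (he : e ∈ M.E) (hfree : ∀ f ∈ M.E, IsFreer M e f)
    (hdel : 𝓜.Mem (M ＼ {e})) : 𝓜.Mem M := by
  by_cases hcl : e ∈ M.closure (M.E \ {e})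
  · refine h.isFreeExt hdel (isFreeExt_deleteElem (F := M.E \ {e}) he subset_rfl fun X hX ↦ ?_)
    refine ⟨fun heX f hf ↦ ?_, fun hX' ↦ M.closure_subset_closure_of_subset_closure hX' hcl⟩
    by_cases hfX : f ∈ X
    · exact M.mem_closure_of_mem hfX (hX.trans sdiff_subset)
    · exact hfree f hf.1 X (by grind) heX
  · exact h.coloop _ _ M e hdel ⟨fun h ↦ h.2 rfl, (insert_sdiff_self_of_mem he).symm, rfl,
      (isColoop_iff_notMem_closure_compl he).2 hcl⟩

end Freer

/-- `N` is obtained from `M` by moving the point `b` to a free position on the line through `b`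
and `z`. -/
structure IsMove {α : Type*} (M : Matroid α) (b z : α) (N : Matroid α) : Prop where
  mem : b ∈ M.E
  mem' : z ∈ M.E
  ne : b ≠ z
  ground_eq : N.E = M.E
  delete_eq : N ＼ {b} = M ＼ {b}
  mem_closure_iff : ∀ X ⊆ M.E \ {b}, b ∈ N.closure X ↔ {b, z} ⊆ M.closure X

/-- The number of dependent sets of a finite matroid; moving a point to a freer position
decreases it. -/
noncomputable def numDep {α : Type*} (M : Matroid α) : ℕ := {X | M.Dep X}.ncard

namespace IsMove

variable {α : Type*} {M N : Matroid α} {X Y : Set α} {b x z : α}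

lemma mem_closure_iff_of_ne (h : IsMove M b z N) (hb : b ∉ X) (hxb : x ≠ b) :
    x ∈ N.closure X ↔ x ∈ M.closure X := by
  have hX : Disjoint X {b} := disjoint_singleton_right.2 hb
  have hcl := congrArg (x ∈ ·.closure X) h.delete_eq
  simpa only [delete_closure_eq_of_disjoint _ hX, mem_sdiff, mem_singleton_iff, hxb,
    not_false_eq_true, and_true, eq_iff_iff] using hcl

lemma indep (h : IsMove M b z N) (hX : M.Indep X) : N.Indep X := by
  have hXb : N.Indep (X \ {b}) := by
    have hX' : (M ＼ {b}).Indep (X \ {b}) := deleteElem_indep_iff.2 ⟨hX.sdiff _, by simp⟩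
    exact (h.delete_eq ▸ hX').of_delete
  by_cases hbX : b ∈ X
  · rw [← insert_sdiff_self_of_mem hbX, hXb.insert_indep_iff_of_notMem (by simp)]
    refine ⟨h.ground_eq ▸ h.mem, fun hb ↦ hX.notMem_closure_sdiff_of_mem hbX ?_⟩
    exact (h.mem_closure_iff _ (sdiff_subset_sdiff_left hX.subset_ground)).1 hb (mem_insert _ _)
  · rwa [sdiff_singleton_eq_self hbX] at hXb

lemma contract_eq (h : IsMove M b z N) : N ／ {z} = M ／ {z} := by
  have hbz := h.ne
  have hdisj : Disjoint ({z} : Set α) {b} := by simpa using hbz.symm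
  refine ext_deleteElem (e := b) ⟨h.ground_eq ▸ h.mem, hbz⟩ ⟨h.mem, hbz⟩ ?_ fun X hX ↦ ?_
  · rw [contract_delete_comm _ hdisj, h.delete_eq, contract_delete_comm _ hdisj]
  · have hXz : X ∪ {z} ⊆ M.E \ {b} :=
      union_subset (hX.trans (by simp only [contract_ground, h.ground_eq]; grind))
        (by simpa using ⟨h.mem', hbz.symm⟩)
    have hz : z ∈ M.closure (X ∪ {z}) := M.mem_closure_of_mem (by simp) (hXz.trans sdiff_subset)
    rw [contract_closure_eq, contract_closure_eq, mem_sdiff, mem_sdiff, h.mem_closure_iff _ hXz,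
      pair_subset_iff, and_iff_left hz]

lemma numDep_lt [M.Finite] (h : IsMove M b z N) (hY : Y ⊆ M.E \ {b}) (hb : b ∈ M.closure Y)
    (hz : z ∉ M.closure Y) : numDep N < numDep M := by
  refine ncard_lt_ncard ⟨fun X hX ↦ ⟨fun hi ↦ hX.not_indep (h.indep hi), h.ground_eq ▸ hX.2⟩,
    fun hsub ↦ ?_⟩ (M.ground_finite.finite_subsets.subset fun _ h ↦ h.subset_ground)
  obtain ⟨I, hI⟩ := M.exists_isBasis Y (hY.trans sdiff_subset)
  have hbI : b ∉ I := fun hbI ↦ (hY (hI.subset hbI)).2 rfl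
  have hdep : M.Dep (insert b I) := by
    rw [hI.indep.insert_dep_iff, hI.closure_eq_closure]
    exact ⟨hb, hbI⟩
  refine (hsub hdep).not_indep ?_
  rw [(h.indep hI.indep).insert_indep_iff_of_notMem hbI]
  refine ⟨h.ground_eq ▸ h.mem, fun hbN ↦ hz ?_⟩
  rw [← hI.closure_eq_closure]
  exact (h.mem_closure_iff I (hI.subset.trans hY)).1 hbN (by simp)

end IsMove

lemma IsFreeExt.exists_isMove {α : Type*} {M P : Matroid α} {b x z : α}
    (hP : IsFreeExt M {b, z} x P) (hbz : b ≠ z) :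
    ∃ N, IsMove M b z N ∧ (P ＼ {b}).Isomorphic N := by
  classical
  obtain ⟨hb, hz⟩ := pair_subset_iff.1 hP.subset_ground
  have hbx : b ≠ x := fun h ↦ hP.notMem (h ▸ hb)
  set σ := Equiv.swap x b
  have hswap {X : Set α} (hX : X ⊆ M.E \ {b}) : σ '' X = X := by
    refine (image_congr fun y hy ↦ ?_).trans (image_id X)
    exact Equiv.swap_apply_of_ne_of_ne (ne_of_mem_of_not_mem (hX hy).1 hP.notMem) (hX hy).2
  have hbP : (P ＼ {b}).E = insert x (M.E \ {b}) := by
    rw [delete_ground, hP.ground_eq, insert_sdiff_of_notMem _ (by simpa using hbx.symm)]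
  have hE : ((P ＼ {b}).mapEquiv σ).E = M.E := by
    rw [mapEquiv_ground_eq, hbP, image_insert_eq, hswap subset_rfl, Equiv.swap_apply_left,
      insert_sdiff_self_of_mem hb]
  refine ⟨(P ＼ {b}).mapEquiv σ, ⟨hb, hz, hbz, hE, ?_, fun X hX ↦ ?_⟩, ?_⟩
  · refine ext_indep (by rw [delete_ground, hE, delete_ground]) fun I hI ↦ ?_
    rw [delete_ground, hE] at hI
    rw [deleteElem_indep_iff, mapEquiv_indep_iff, Equiv.symm_swap, hswap hI, deleteElem_indep_iff,
      deleteElem_indep_iff, hP.indep_iff (hI.trans sdiff_subset), and_assoc, and_self]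
  · have hXb : Disjoint X {b} := (subset_sdiff.1 hX).2
    rw [mapEquiv_eq_map, map_closure_eq, ← Equiv.image_symm_eq_preimage, Equiv.symm_swap, hswap hX,
      Equiv.image_eq_preimage_symm, mem_preimage, Equiv.symm_swap, Equiv.swap_apply_right,
      delete_closure_eq_of_disjoint _ hXb, mem_sdiff, and_iff_left (by simpa using hbx.symm),
      hP.mem_closure_iff X (hX.trans sdiff_subset)]
  · exact mapEquiv_eq_map σ ▸ isomorphic_map _ _ _

lemma MatroidClass.IsNatural.exists_isMove {α : Type u} [Infinite α] {𝓜 : MatroidClass.{u}}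
    {M : Matroid α} {b z : α} (h : 𝓜.IsNatural) (hM : 𝓜.Mem M) (hb : b ∈ M.E) (hz : z ∈ M.E)
    (hbz : b ≠ z) : ∃ N, IsMove M b z N ∧ 𝓜.Mem N := by
  have := 𝓜.finite_of_mem _ hM
  obtain ⟨x, hx⟩ := M.ground_finite.exists_notMem
  have hP := isFreeExt_freeExt (pair_subset hb hz) hx
  obtain ⟨N, hN, hPN⟩ := hP.exists_isMove hbz
  exact ⟨N, hN, h.isomorphic _ _ _ _ (h.delete (h.isFreeExt hM hP) _) hPN⟩

section Obstruction

variable {α : Type u} {𝓜 𝓜₁ 𝓜₂ : MatroidClass.{u}} {P R : Matroid α} {F S Y Y' : Set α}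
  {e e' p : α}

lemma IsIncomparable.isFreeExt (h : IsIncomparable R e e' Y Y') (hP : IsFreeExt R F p P)
    (hY : Y ⊆ R.E) (hY' : Y' ⊆ R.E) : IsIncomparable P e e' Y Y' where
  mem := hP.closure_subset Y h.mem
  notMem he' := h.notMem ((hP.mem_closure_iff_of_mem hY h.symm.mem_ground).1 he')
  mem' := hP.closure_subset Y' h.mem'
  notMem' he := h.notMem' ((hP.mem_closure_iff_of_mem hY' h.mem_ground).1 he)

lemma IsIncomparable.two_le_encard (h : IsIncomparable R e e' Y Y') (hY : Y ⊆ R.E \ {e, e'})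
    (hY' : Y' ⊆ R.E \ {e, e'}) : 2 ≤ (R.E \ {e, e'}).encard := by
  obtain ⟨y, hy, -⟩ := not_subset.1 fun hsub : Y ⊆ Y' ↦
    h.notMem' (R.closure_subset_closure hsub h.mem)
  obtain ⟨z, hz, hzY⟩ := not_subset.1 fun hsub : Y' ⊆ Y ↦
    h.notMem (R.closure_subset_closure hsub h.mem')
  rw [← encard_pair (ne_of_mem_of_not_mem hy hzY)]
  exact encard_le_encard (pair_subset (hY hy) (hY' hz))

/-- Since `p` lies on the line through `e` and `e'`, contracting it makes `e` and `e'` parallel. -/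
lemma IsFreeExt.mem_contract (hP : IsFreeExt R {e, e'} p P) (h : 𝓜.IsNatural) (hee' : e ≠ e')
    (he : 𝓜.Mem (P ＼ {e})) : 𝓜.Mem (P ／ {p}) := by
  obtain ⟨heR, heR'⟩ := pair_subset_iff.1 hP.subset_ground
  have hpe : p ≠ e := fun h ↦ hP.notMem (h ▸ heR)
  have hpe' : p ≠ e' := fun h ↦ hP.notMem (h ▸ heR')
  have hdel : 𝓜.Mem (P ／ {p} ＼ {e}) := by
    rw [contract_delete_comm _ (by simpa using hpe)]
    exact h.contract he _
  refine h.isFreeExt hdel (isFreeExt_deleteElem (F := {e'}) ⟨hP.ground_subset heR, hpe.symm⟩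
    (by simpa using ⟨⟨hP.ground_subset heR', hpe'.symm⟩, hee'.symm⟩) fun X hX ↦ ?_)
  have hXP : X ∪ {p} ⊆ P.E := union_subset
    (hX.trans (sdiff_subset.trans sdiff_subset)) (singleton_subset_iff.2 hP.mem_ground)
  have hp : p ∈ P.closure (X ∪ {p}) := P.mem_closure_of_mem (by simp) hXP
  rw [singleton_subset_iff, contract_closure_eq, mem_sdiff, mem_sdiff,
    and_iff_left (notMem_singleton_iff.2 hpe.symm),
    and_iff_left (notMem_singleton_iff.2 hpe'.symm)]
  exact ⟨fun hx ↦ P.closure_subset_closure_of_subset_closure (pair_subset hp hx)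
      hP.mem_closure_pair,
    fun hx ↦ P.closure_subset_closure_of_subset_closure (pair_subset hp hx)
      (pair_comm e e' ▸ hP).mem_closure_pair⟩

lemma IsFreeExt.isObstruction (hP : IsFreeExt R {e, e'} p P) (h : 𝓜.IsNatural)
    (hR : IsIncomparable R e e' Y Y') (hY : Y ⊆ R.E \ {e, e'}) (hY' : Y' ⊆ R.E \ {e, e'})
    (hR𝓜 : ¬ 𝓜.Mem R) (hdel : ∀ f ∈ R.E, 𝓜.Mem (R ＼ {f})) (hcon : ∀ f ∈ R.E, 𝓜.Mem (R ／ {f}))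
    (he : 𝓜.Mem (P ＼ {e})) (he' : 𝓜.Mem (P ＼ {e'})) : IsObstruction 𝓜 P e e' p Y Y' := by
  have hp : p ∉ ({e, e'} : Set α) := fun h ↦ hP.notMem (hP.subset_ground h)
  have hPE : P.E \ {e, e'} = insert p (R.E \ {e, e'}) := by
    rw [hP.ground_eq, insert_sdiff_of_notMem _ hp]
  have hRP : R.E \ {e, e'} ⊆ P.E \ {e, e'} := hPE ▸ subset_insert _ _
  exact {
    side := hR.isFreeExt hP (hY.trans sdiff_subset) (hY'.trans sdiff_subset)
    subset := hY.trans hRP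
    subset' := hY'.trans hRP
    mem := hPE ▸ mem_insert _ _
    mem_closure := (hP.mem_closure_iff _ hP.subset_ground).2 (R.subset_closure _ hP.subset_ground)
    mem_closure_left := (pair_comm e e' ▸ hP).mem_closure_pair
    mem_closure_right := hP.mem_closure_pair
    three_le := by
      rw [hPE, encard_insert_of_notMem fun h ↦ hP.notMem h.1]
      exact add_le_add_left (hR.two_le_encard hY hY') 1
    notMem := fun hmem ↦ hR𝓜 (hP.delete_eq ▸ h.delete hmem _)
    mem_delete := fun f hf hfp ↦ by
      have hfR : f ∈ R.E := (hP.ground_eq ▸ hf : f ∈ insert p R.E).resolve_left hfp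
      obtain rfl | hfe := eq_or_ne f e
      · exact he
      obtain rfl | hfe' := eq_or_ne f e'
      · exact he'
      exact h.isFreeExt (hdel f hfR) (hP.delete hfp.symm (by simp [hfe, hfe']))
    mem_contract := fun f hf ↦ by
      obtain rfl | hfR := hPE ▸ hf
      · exact hP.mem_contract h hR.ne he
      · exact h.isFreeExt (hcon f hfR.1) (hP.contract (singleton_subset_iff.2 hfR.1)
          (disjoint_singleton_right.2 hfR.2)) }

lemma exists_map_disjoint {γ : Type*} [Infinite α] (M : Matroid γ) [M.Finite] (hS : S.Finite) :
    ∃ (φ : γ → α) (hφ : InjOn φ M.E), Disjoint (M.map φ hφ).E S := by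
  obtain ⟨φ, hφS, hφ⟩ := M.ground_finite.exists_injOn_of_encard_le (t := Sᶜ)
    (hS.infinite_compl.encard_eq ▸ le_top)
  exact ⟨φ, hφ, disjoint_left.2 fun _ ⟨_, hx, hxy⟩ ↦ hxy ▸ hφS hx⟩

namespace MatroidClass.IsNatural

lemma nonempty_of_notMem {N : Matroid α} (h : 𝓜.IsNatural) (hN : 𝓜.Mem N) (hR : ¬ 𝓜.Mem R) :
    R.E.Nonempty := by
  by_contra! h0
  refine hR ?_
  rw [ground_eq_empty_iff.1 h0, ← ground_eq_empty_iff.1 (show (N ＼ N.E).E = ∅ by simp)]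
  exact h.delete hN _

lemma exists_isIncomparable {N : Matroid α} [R.Finite] (h : 𝓜.IsNatural) (hN : 𝓜.Mem N)
    (hR : ¬ 𝓜.Mem R) (hdel : ∀ f ∈ R.E, 𝓜.Mem (R ＼ {f})) :
    ∃ e e' Y Y', Y ⊆ R.E \ {e, e'} ∧ Y' ⊆ R.E \ {e, e'} ∧ IsIncomparable R e e' Y Y' := by
  suffices ∃ e ∈ R.E, ∃ e' ∈ R.E, ¬ IsFreer R e e' ∧ ¬ IsFreer R e' e by
    obtain ⟨e, -, e', -, he, he'⟩ := this
    exact ⟨e, e', exists_isIncomparable_of_not_isFreer he he'⟩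
  by_contra! hall
  obtain ⟨e, he, hfree⟩ := exists_forall_isFreer (h.nonempty_of_notMem hN hR)
    fun e he f hf ↦ or_iff_not_imp_left.2 (hall e he f hf)
  exact hR (h.mem_of_forall_isFreer he hfree (hdel e he))

end MatroidClass.IsNatural

namespace MatroidClass

lemma exists_minimal_notMem [Infinite α] (h₁ : 𝓜₁.IsNatural) (h₂ : 𝓜₂.IsNatural)
    (hlt : 𝓜₁.ProperSubclass 𝓜₂) (hS : S.Finite) :
    ∃ R : Matroid α, 𝓜₂.Mem R ∧ ¬ 𝓜₁.Mem R ∧ Disjoint R.E S ∧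
      (∀ M : Matroid α, 𝓜₂.Mem M → M.E ⊂ R.E → 𝓜₁.Mem M) ∧
      ∀ M : Matroid α, 𝓜₂.Mem M → M.E = R.E → numDep M < numDep R → 𝓜₁.Mem M := by
  let candidates : Set (Matroid α) := {M | 𝓜₂.Mem M ∧ ¬ 𝓜₁.Mem M ∧ Disjoint M.E S}
  have hne : candidates.Nonempty := by
    obtain ⟨γ, M, hM₂, hM₁⟩ := hlt.2
    have := 𝓜₂.finite_of_mem M hM₂
    obtain ⟨φ, hφ, hd⟩ := exists_map_disjoint (α := α) M hS
    exact ⟨M.map φ hφ, h₂.map hM₂ φ hφ, fun hmem ↦ hM₁ (h₁.isomorphic _ _ _ _ hmem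
      (isomorphic_symm (isomorphic_map M φ hφ))), hd⟩
  obtain ⟨R, ⟨hR₂, hR₁, hd⟩, hmin⟩ := (InvImage.wf
    (fun M : Matroid α ↦ toLex (M.E.ncard, numDep M)) wellFounded_lt).has_min candidates hne
  refine ⟨R, hR₂, hR₁, hd, fun M hM hss ↦ ?_, fun M hM hE hlt ↦ ?_⟩ <;> by_contra hM₁
  · refine hmin M ⟨hM, hM₁, hd.mono_left hss.subset⟩ (Prod.Lex.toLex_lt_toLex.2 (.inl ?_))
    exact ncard_lt_ncard hss (𝓜₂.finite_of_mem R hR₂).ground_finite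
  · exact hmin M ⟨hM, hM₁, hE ▸ hd⟩ (Prod.Lex.toLex_lt_toLex.2 (.inr ⟨congrArg ncard hE, hlt⟩))

lemma exists_isObstruction [Infinite α] {N : Matroid α} (h₁ : 𝓜₁.IsNatural) (h₂ : 𝓜₂.IsNatural)
    (hlt : 𝓜₁.ProperSubclass 𝓜₂) (hN : 𝓜₁.Mem N) (hS : S.Finite) :
    ∃ (R : Matroid α) (e e' p : α) (Y Y' : Set α),
      IsObstruction 𝓜₁ R e e' p Y Y' ∧ 𝓜₂.Mem R ∧ Disjoint R.E S := by
  obtain ⟨R, hR₂, hR₁, hd, hsmall, hdep⟩ := exists_minimal_notMem h₁ h₂ hlt hS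
  have := 𝓜₂.finite_of_mem R hR₂
  have hss (f) (hf : f ∈ R.E) : R.E \ {f} ⊂ R.E := sdiff_singleton_ssubset.2 hf
  have hdel (f) (hf : f ∈ R.E) : 𝓜₁.Mem (R ＼ {f}) := hsmall _ (h₂.delete hR₂ _) (hss f hf)
  have hcon (f) (hf : f ∈ R.E) : 𝓜₁.Mem (R ／ {f}) := hsmall _ (h₂.contract hR₂ _) (hss f hf)
  obtain ⟨e, e', Y, Y', hY, hY', hR⟩ := h₁.exists_isIncomparable hN hR₁ hdel
  obtain ⟨p, hp⟩ := (R.ground_finite.union hS).exists_notMem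
  rw [mem_union, not_or] at hp
  have hP := isFreeExt_freeExt (pair_subset hR.mem_ground hR.symm.mem_ground) hp.1
  set P := freeExt R {e, e'} p
  have hP₂ := h₂.isFreeExt hR₂ hP
  have hmove {b z : α} {Z Z' : Set α} (hP : IsFreeExt R {b, z} p P) (hZ : Z ⊆ R.E \ {b, z})
      (hinc : IsIncomparable R b z Z Z') : 𝓜₁.Mem (P ＼ {b}) := by
    obtain ⟨M, hM, hPM⟩ := hP.exists_isMove hinc.ne
    refine h₁.isomorphic _ _ _ _ (hdep M (h₂.isomorphic _ _ _ _ (h₂.delete hP₂ _) hPM) hM.ground_eq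
      ?_) (isomorphic_symm hPM)
    exact hM.numDep_lt (hZ.trans (sdiff_subset_sdiff_right (by simp))) hinc.mem hinc.notMem
  refine ⟨P, e, e', p, Y, Y', hP.isObstruction h₁ hR hY hY' hR₁ hdel hcon (hmove hP hY hR)
    (hmove (pair_comm e e' ▸ hP) (pair_comm e e' ▸ hY') hR.symm), hP₂, ?_⟩
  rw [hP.ground_eq, disjoint_insert_left]
  exact ⟨hp.2, hd⟩

end MatroidClass

end Obstruction

/-- `A` and `B` partition the ground set of `M` into two independent sets spanning hyperplanes; the
point `z₁` of `A` is not spanned by `B`, and the point `z₂` of `B` is not spanned by `A`. -/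
structure IsHyperplanePair {α : Type*} (M : Matroid α) (A B : Set α) (z₁ z₂ : α) : Prop where
  union_eq : A ∪ B = M.E
  disjoint : Disjoint A B
  mem : z₁ ∈ A
  mem' : z₂ ∈ B
  isBase : M.IsBase (insert z₂ A)
  isBase' : M.IsBase (insert z₁ B)

/-- `G` is obtained from `M` by adding a point `g` freely to the span of `A` and a point `g'` freely
to the span of `B`. -/
structure IsFreePairExt {α : Type*} (M : Matroid α) (A B : Set α) (g g' : α) (G : Matroid α) :
    Prop where
  ground_eq : G.E \ {g, g'} = M.E
  mem_closure_iff : ∀ X ⊆ M.E, g ∈ G.closure X ↔ A ⊆ M.closure X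
  mem_closure_iff' : ∀ X ⊆ M.E, g' ∈ G.closure X ↔ B ⊆ M.closure X

namespace IsFreePairExt

variable {α : Type*} {M P G : Matroid α} {A B : Set α} {g g' : α}

lemma symm (h : IsFreePairExt M A B g g' G) : IsFreePairExt M B A g' g G :=
  ⟨pair_comm g g' ▸ h.ground_eq, h.mem_closure_iff', h.mem_closure_iff⟩

lemma of_isFreeExt (hP : IsFreeExt M A g P) (hG : IsFreeExt P B g' G) (hB : B ⊆ M.E) :
    IsFreePairExt M A B g g' G where
  ground_eq := by
    have hg' : g' ∉ M.E := fun h ↦ hG.notMem (hP.ground_subset h)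
    rw [hG.ground_eq, hP.ground_eq]
    grind [hP.notMem]
  mem_closure_iff X hX := by
    rw [hG.mem_closure_iff_of_mem (hX.trans hP.ground_subset) hP.mem_ground,
      hP.mem_closure_iff X hX]
  mem_closure_iff' X hX := by
    rw [hG.mem_closure_iff X (hX.trans hP.ground_subset), hP.subset_closure_iff hX hB]

end IsFreePairExt

namespace IsHyperplanePair

variable {α : Type*} {M G : Matroid α} {A B X : Set α} {f g g' z₁ z₂ : α}

lemma symm (h : IsHyperplanePair M A B z₁ z₂) : IsHyperplanePair M B A z₂ z₁ :=
  ⟨union_comm A B ▸ h.union_eq, h.disjoint.symm, h.mem', h.mem, h.isBase', h.isBase⟩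

lemma indep (h : IsHyperplanePair M A B z₁ z₂) : M.Indep A :=
  h.isBase.indep.subset (subset_insert _ _)

lemma notMem_closure (h : IsHyperplanePair M A B z₁ z₂) : z₂ ∉ M.closure A :=
  ((h.indep.insert_indep_iff_of_notMem (h.disjoint.notMem_of_mem_right h.mem')).1
    h.isBase.indep).2

lemma closure_eq_self (h : IsHyperplanePair M A B z₁ z₂) (hAB : Disjoint (M.closure A) B) :
    M.closure A = A :=
  (hAB.subset_left_of_subset_union (h.union_eq ▸ M.closure_subset_ground A)).antisymm
    (M.subset_closure A h.indep.subset_ground)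

lemma closure_eq_ground (h : IsHyperplanePair M A B z₁ z₂) (hA : M.closure A = A) (hX : X ⊆ M.E)
    (hAX : A ⊆ M.closure X) (hXA : ¬ X ⊆ A) : M.closure X = M.E := by
  obtain ⟨x, hxX, hxA⟩ := not_subset.1 hXA
  have hx : x ∈ M.closure (insert z₂ A) \ M.closure A := by
    rw [h.isBase.closure_eq, hA]
    exact ⟨hX hxX, hxA⟩
  have hz₂ : z₂ ∈ M.closure X := M.closure_subset_closure_of_subset_closure
    (insert_subset (M.mem_closure_of_mem hxX hX) hAX) (closure_exchange hx).1
  exact (M.closure_subset_ground X).antisymm (h.isBase.closure_eq ▸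
    M.closure_subset_closure_of_subset_closure (insert_subset hz₂ hAX))

lemma closure_eq_ground_of_notMem (h : IsHyperplanePair M A B z₁ z₂) (hA : M.closure A = A)
    (hX : X ⊆ M.E) (hAX : A ⊆ M.closure X) (hf : f ∈ A) (hfX : f ∉ X) : M.closure X = M.E :=
  h.closure_eq_ground hA hX hAX fun hXA ↦ h.indep.notMem_closure_sdiff_of_mem hf
    (M.closure_subset_closure (subset_sdiff_singleton hXA hfX) (hAX hf))

lemma isIncomparable (h : IsHyperplanePair M A B z₁ z₂) (hA : M.closure A = A)
    (hB : M.closure B = B) (hG : IsFreePairExt M A B g g' G) : IsIncomparable G g g' A B where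
  mem := (hG.mem_closure_iff A h.indep.subset_ground).2 (M.subset_closure A h.indep.subset_ground)
  notMem hg' := h.disjoint.notMem_of_mem_right h.mem'
    (hA ▸ (hG.mem_closure_iff' A h.indep.subset_ground).1 hg' h.mem')
  mem' := (hG.mem_closure_iff' B h.symm.indep.subset_ground).2
    (M.subset_closure B h.symm.indep.subset_ground)
  notMem' hg := h.disjoint.notMem_of_mem_left h.mem
    (hB ▸ (hG.mem_closure_iff B h.symm.indep.subset_ground).1 hg h.mem)

/-- A set avoiding the element `f` of `A` that spans `A` spans everything. -/
lemma isFreer_delete (h : IsHyperplanePair M A B z₁ z₂) (hA : M.closure A = A)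
    (hG : IsFreePairExt M A B g g' G) (hf : f ∈ A) : IsFreer (G ＼ {f}) g g' := by
  intro X hX hgX
  have hfE := h.indep.subset_ground hf
  rw [delete_ground, sdiff_sdiff_comm, hG.ground_eq, subset_sdiff] at hX
  rw [← hG.ground_eq] at hfE
  rw [delete_closure_eq_of_disjoint _ hX.2] at hgX ⊢
  have hcl := h.closure_eq_ground_of_notMem hA hX.1 ((hG.mem_closure_iff X hX.1).1 hgX.1) hf
    (disjoint_singleton_right.1 hX.2)
  refine ⟨(hG.mem_closure_iff' X hX.1).2 (hcl ▸ h.symm.indep.subset_ground), ?_⟩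
  rintro rfl
  exact hfE.2 (by simp)

/-- A set that spans `B` together with the element `f` of `A` spans everything. -/
lemma isFreer_contract (h : IsHyperplanePair M A B z₁ z₂) (hB : M.closure B = B)
    (hG : IsFreePairExt M A B g g' G) (hf : f ∈ A) : IsFreer (G ／ {f}) g' g := by
  intro X hX hgX
  have hfE := h.indep.subset_ground hf
  rw [pair_comm, contract_ground, sdiff_sdiff_comm, hG.ground_eq, subset_sdiff] at hX
  have hXf : X ∪ {f} ⊆ M.E := union_subset hX.1 (singleton_subset_iff.2 hfE)
  rw [← hG.ground_eq] at hfE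
  rw [contract_closure_eq] at hgX ⊢
  have hcl := h.symm.closure_eq_ground hB hXf ((hG.mem_closure_iff' _ hXf).1 hgX.1)
    fun hsub ↦ h.disjoint.notMem_of_mem_left hf (hsub (.inr rfl))
  refine ⟨(hG.mem_closure_iff _ hXf).2 (hcl ▸ h.indep.subset_ground), ?_⟩
  rintro rfl
  exact hfE.2 (by simp)

lemma isGadget (h : IsHyperplanePair M A B z₁ z₂) (hA : M.closure A = A) (hB : M.closure B = B)
    (h3 : 3 ≤ M.E.encard) (hG : IsFreePairExt M A B g g' G) : IsGadget G g g' A B where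
  side := h.isIncomparable hA hB hG
  union_eq := h.union_eq.trans hG.ground_eq.symm
  three_le := h.union_eq ▸ h3
  freer_delete _ hf := hf.imp (h.isFreer_delete hA hG) (h.symm.isFreer_delete hB hG.symm)
  freer_contract _ hf := hf.symm.imp (h.symm.isFreer_contract hA hG.symm)
    (h.isFreer_contract hB hG)

end IsHyperplanePair

section Move

variable {α : Type*} {M N : Matroid α} {A B : Set α} {b z₁ z₂ : α}

lemma IsMove.isHyperplanePair [M.Finite] (hN : IsMove M b z₂ N) (h : IsHyperplanePair M A B z₁ z₂)
    (hb : b ∈ B) : IsHyperplanePair N A B z₁ z₂ := by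
  have hbA : b ∉ insert z₂ A := by
    simpa [hN.ne] using h.disjoint.notMem_of_mem_right hb
  have hbase : N.IsBase (insert z₂ A) := by
    refine (hN.indep h.isBase.indep).isBase_of_ground_subset_closure fun x hx ↦ ?_
    rw [hN.ground_eq] at hx
    obtain rfl | hxb := eq_or_ne x b
    · rw [hN.mem_closure_iff _ (subset_sdiff_singleton h.isBase.subset_ground hbA),
        h.isBase.closure_eq]
      exact pair_subset hN.mem hN.mem'
    · rwa [hN.mem_closure_iff_of_ne hbA hxb, h.isBase.closure_eq]
  refine ⟨h.union_eq.trans hN.ground_eq.symm, h.disjoint, h.mem, h.mem', hbase, ?_⟩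
  have hi := hN.indep h.isBase'.indep
  refine hi.isBase_of_eRk_ge (M.set_finite _ h.isBase'.subset_ground) ?_
  rw [hi.eRk_eq_encard, ← h.isBase.encard_eq_encard_of_isBase h.isBase', hbase.encard_eq_eRank]

lemma IsMove.closure_inter_ssubset (hN : IsMove M b z₂ N) (h : IsHyperplanePair M A B z₁ z₂)
    (hb : b ∈ M.closure A ∩ B) :
    N.closure A ∩ B ∪ N.closure B ∩ A ⊂ M.closure A ∩ B ∪ M.closure B ∩ A := by
  have hbA : b ∉ A := h.disjoint.notMem_of_mem_right hb.2
  have hbN : b ∉ N.closure A := by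
    rw [hN.mem_closure_iff A (subset_sdiff_singleton h.indep.subset_ground hbA)]
    exact fun hsub ↦ h.notMem_closure (hsub (by simp))
  have hA : N.closure A ∩ B ⊆ M.closure A ∩ B := fun x hx ↦
    ⟨(hN.mem_closure_iff_of_ne hbA (ne_of_mem_of_not_mem hx.1 hbN)).1 hx.1, hx.2⟩
  have hB : N.closure B ∩ A ⊆ M.closure B ∩ A := fun x hx ↦ by
    have hxB := h.disjoint.notMem_of_mem_left hx.2
    refine ⟨by_contra fun hxM ↦ ?_, hx.2⟩
    have hi : M.Indep (insert x B) := (h.symm.indep.insert_indep_iff_of_notMem hxB).2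
      ⟨h.indep.subset_ground hx.2, hxM⟩
    exact (((hN.indep h.symm.indep).insert_indep_iff_of_notMem hxB).1 (hN.indep hi)).2 hx.1
  refine ssubset_of_subset_of_ne (union_subset_union hA hB) fun heq ↦ ?_
  obtain hbN' | hbN' := (heq ▸ .inl hb : b ∈ N.closure A ∩ B ∪ N.closure B ∩ A)
  · exact hbN hbN'.1
  · exact hbA hbN'.2

end Move

section Flats

variable {α : Type u} [Infinite α] {𝓜 : MatroidClass.{u}} {M : Matroid α} {A B : Set α}
  {b z₁ z₂ : α}

namespace MatroidClass.IsNatural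

lemma exists_closure_inter_ssubset (h : 𝓜.IsNatural) (hM : 𝓜.Mem M)
    (hAB : IsHyperplanePair M A B z₁ z₂) (hb : b ∈ M.closure A ∩ B) :
    ∃ N, 𝓜.Mem N ∧ IsHyperplanePair N A B z₁ z₂ ∧ N ／ {z₁, z₂} = M ／ {z₁, z₂} ∧
      N.closure A ∩ B ∪ N.closure B ∩ A ⊂ M.closure A ∩ B ∪ M.closure B ∩ A := by
  have := 𝓜.finite_of_mem M hM
  have hBE := hAB.symm.indep.subset_ground
  obtain ⟨N, hN, hNmem⟩ := h.exists_isMove hM (hBE hb.2) (hBE hAB.mem')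
    (ne_of_mem_of_not_mem hb.1 hAB.notMem_closure)
  refine ⟨N, hNmem, hN.isHyperplanePair hAB hb.2, ?_, hN.closure_inter_ssubset hAB hb⟩
  rw [pair_comm, ← singleton_union, ← contract_contract, hN.contract_eq, contract_contract]

lemma exists_flats (h : 𝓜.IsNatural) (hM : 𝓜.Mem M) (hAB : IsHyperplanePair M A B z₁ z₂) :
    ∃ N, 𝓜.Mem N ∧ IsHyperplanePair N A B z₁ z₂ ∧ N ／ {z₁, z₂} = M ／ {z₁, z₂} ∧
      N.closure A = A ∧ N.closure B = B := by
  induction hn : (M.closure A ∩ B ∪ M.closure B ∩ A).ncard using Nat.strong_induction_on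
    generalizing M with
  | _ n ih =>
  obtain hD | ⟨b, hb⟩ := (M.closure A ∩ B ∪ M.closure B ∩ A).eq_empty_or_nonempty
  · rw [union_empty_iff, ← disjoint_iff_inter_eq_empty, ← disjoint_iff_inter_eq_empty] at hD
    exact ⟨M, hM, hAB, rfl, hAB.closure_eq_self hD.1, hAB.symm.closure_eq_self hD.2⟩
  · have := 𝓜.finite_of_mem M hM
    obtain ⟨N, hN, hNAB, hNM, hss⟩ : ∃ N, 𝓜.Mem N ∧ IsHyperplanePair N A B z₁ z₂ ∧
        N ／ {z₁, z₂} = M ／ {z₁, z₂} ∧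
        N.closure A ∩ B ∪ N.closure B ∩ A ⊂ M.closure A ∩ B ∪ M.closure B ∩ A := by
      obtain hb | hb := hb
      · exact h.exists_closure_inter_ssubset hM hAB hb
      · obtain ⟨N, hN, hNAB, hNM, hss⟩ := h.exists_closure_inter_ssubset hM hAB.symm hb
        exact ⟨N, hN, hNAB.symm, pair_comm z₂ z₁ ▸ hNM, by rwa [union_comm, union_comm (_ ∩ B)]⟩
    have hfin : (M.closure A ∩ B ∪ M.closure B ∩ A).Finite := M.ground_finite.subset
      (hAB.union_eq ▸ union_subset (inter_subset_right.trans subset_union_right)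
        (inter_subset_right.trans subset_union_left))
    obtain ⟨N', hN', hN'AB, hN'N, hflats⟩ := ih _ (hn ▸ ncard_lt_ncard hss hfin) hN hNAB rfl
    exact ⟨N', hN', hN'AB, hN'N.trans hNM, hflats⟩

end MatroidClass.IsNatural

end Flats

section Coloop

variable {α : Type*} {M M' : Matroid α} {X : Set α} {c : α}

lemma exists_isColoopExtension (hc : c ∉ M.E) : ∃ M', M.IsColoopExtension c M' := by
  have hd : Disjoint M.E (freeOn {c}).E := disjoint_singleton_right.2 hc
  have hE : (M.disjointSum (freeOn {c}) hd).E = insert c M.E := by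
    rw [disjointSum_ground_eq, freeOn_ground, union_singleton]
  refine ⟨M.disjointSum (freeOn {c}) hd, hc, hE, ext_closure fun X ↦ ?_, ?_⟩
  · have hcl : c ∉ M.closure (X \ {c}) := fun h ↦ hc (M.closure_subset_ground _ h)
    rw [delete_closure_eq, disjointSum_closure_eq, freeOn_closure_eq, union_sdiff_distrib,
      sdiff_singleton_eq_self hcl, ← M.closure_inter_ground X, ← M.closure_inter_ground (X \ {c}),
      ← inter_sdiff_right_comm, sdiff_singleton_eq_self fun h ↦ hc h.2]
    simp
  · rw [isColoop_iff_notMem_closure_compl (hE ▸ mem_insert c M.E), hE,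
      insert_sdiff_self_of_notMem hc, disjointSum_closure_eq, freeOn_closure_eq]
    simp [hc]

lemma contract_eq_of_isColoopExtension (h : M.IsColoopExtension c M') : M' ／ {c} = M := by
  rw [contract_eq_delete_of_subset_coloops (singleton_subset_iff.2 h.2.2.2), h.2.2.1]

lemma indep_insert_of_isColoopExtension (h : M.IsColoopExtension c M') (hX : M.Indep X) :
    M'.Indep (insert c X) := by
  rw [← contract_eq_of_isColoopExtension h, h.2.2.2.isNonloop.contractElem_indep_iff] at hX
  exact hX.2

lemma isBase_insert_of_isColoopExtension (h : M.IsColoopExtension c M') (hX : M.IsBase X) :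
    M'.IsBase (insert c X) := by
  rw [← contract_eq_of_isColoopExtension h,
    h.2.2.2.isNonloop.indep.contract_isBase_iff, union_singleton] at hX
  exact hX.1

lemma notMem_closure_of_isColoopExtension (h : M.IsColoopExtension c M') (hX : X ⊆ M.E) :
    c ∉ M'.closure X :=
  fun hc ↦ h.1 (hX (h.2.2.2.mem_closure_iff_mem.1 hc))

end Coloop

lemma IsFreeExt.isRestriction {α : Type*} {M P : Matroid α} {F : Set α} {e : α}
    (h : IsFreeExt M F e P) : M ≤r P :=
  h.delete_eq ▸ P.delete_isRestriction {e}

lemma IsFreeExt.isBase_exchange {α : Type*} {M P : Matroid α} {J : Set α} {e t : α}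
    (h : IsFreeExt M M.E e P) (hJ : M.IsBase J) (ht : t ∈ J) : P.IsBase (insert e (J \ {t})) := by
  have heJ : e ∉ J := fun heJ ↦ h.notMem (hJ.subset_ground heJ)
  have hJt : M.Indep (J \ {t}) := hJ.indep.subset sdiff_subset
  refine (h.isBase hJ).exchange_isBase_of_indep heJ ?_
  refine (((h.indep_iff hJt.subset_ground).2 hJt).insert_indep_iff_of_notMem
    fun heJt ↦ heJ heJt.1).2 ⟨h.mem_ground, fun hcl ↦ ?_⟩
  exact hJ.indep.notMem_closure_sdiff_of_mem ht
    ((h.mem_closure_iff _ hJt.subset_ground).1 hcl (hJ.subset_ground ht))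

namespace MatroidClass.IsNatural

variable {α : Type u} [Infinite α] {𝓜 : MatroidClass.{u}} {M N : Matroid α} {A B : Set α} {a : α}

lemma exists_indep_insert (h : 𝓜.IsNatural) (hM : 𝓜.Mem M) (ha : a ∈ M.E) :
    ∃ N c, 𝓜.Mem N ∧ c ∉ M.E ∧ N.E = insert c M.E ∧ N ／ {c} = M ∧
      ∀ X, M.Indep X → N.Indep (insert a X) ∧ N.Indep (insert c X) := by
  have := 𝓜.finite_of_mem M hM
  obtain ⟨c, hc⟩ := M.ground_finite.exists_notMem
  obtain ⟨M', hM'⟩ := exists_isColoopExtension hc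
  have hac : a ≠ c := ne_of_mem_of_not_mem ha hc
  have haE : a ∈ M'.E := hM'.2.1 ▸ .inr ha
  obtain ⟨N, hN, hN𝓜⟩ := h.exists_isMove (h.coloop _ _ _ _ hM hM') haE
    hM'.2.2.2.mem_ground hac
  refine ⟨N, c, hN𝓜, hc, hN.ground_eq.trans hM'.2.1,
    hN.contract_eq.trans (contract_eq_of_isColoopExtension hM'), fun X hX ↦ ?_⟩
  have hcX := indep_insert_of_isColoopExtension hM' hX
  refine ⟨?_, hN.indep hcX⟩
  have hNX := hN.indep (hcX.subset (subset_insert c X))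
  by_cases haX : a ∈ X
  · rwa [insert_eq_of_mem haX]
  refine (hNX.insert_indep_iff_of_notMem haX).2 ⟨hN.ground_eq ▸ haE, fun hcl ↦ ?_⟩
  rw [hN.mem_closure_iff X (subset_sdiff_singleton
    (hX.subset_ground.trans (hM'.2.1 ▸ subset_insert c M.E)) haX)] at hcl
  exact notMem_closure_of_isColoopExtension hM' hX.subset_ground (hcl (by simp))

lemma exists_indep_partition (h : 𝓜.IsNatural) (hM : 𝓜.Mem M) :
    ∃ N C, 𝓜.Mem N ∧ M ≤m N ∧ M.E ∪ C = N.E ∧ Disjoint M.E C ∧ N.Indep M.E ∧ N.Indep C := by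
  have := 𝓜.finite_of_mem M hM
  suffices ∀ A ⊆ M.E, ∃ N C, 𝓜.Mem N ∧ M ≤m N ∧ M.E ∪ C = N.E ∧ Disjoint M.E C ∧
      N.Indep A ∧ N.Indep C from this M.E subset_rfl
  intro A hA
  induction A, M.set_finite A hA using Set.Finite.induction_on with
  | empty => exact ⟨M, ∅, hM, .refl, by simp⟩
  | @insert a A _ _ ih =>
    obtain ⟨ha, hA⟩ := insert_subset_iff.1 hA
    obtain ⟨N, C, hN, hMN, hE, hd, hAi, hCi⟩ := ih hA
    obtain ⟨N', c, hN', hc, hE', hcon, hi⟩ := h.exists_indep_insert hN (hMN.subset ha)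
    refine ⟨N', insert c C, hN', hMN.trans ⟨{c}, ∅, by rw [hcon, delete_empty]⟩, ?_, ?_,
      (hi A hAi).1, (hi C hCi).2⟩
    · rw [hE', ← hE, union_insert]
    · exact disjoint_insert_right.2 ⟨fun hcM ↦ hc (hMN.subset hcM), hd⟩

lemma exists_isBase_superset (h : 𝓜.IsNatural) (hM : 𝓜.Mem M) (hE : A ∪ B = M.E)
    (hd : Disjoint A B) (hA : M.Indep A) :
    ∃ N A', 𝓜.Mem N ∧ M ≤m N ∧ A' ∪ B = N.E ∧ Disjoint A' B ∧ N.IsBase A' ∧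
      ∀ I, M.IsBase I → N.IsBase I := by
  obtain ⟨J, hJ, hAJ⟩ := hA.exists_isBase_superset
  clear hA
  induction hn : (J \ A).ncard generalizing M A J with
  | zero =>
    have := 𝓜.finite_of_mem M hM
    obtain rfl : A = J := hAJ.antisymm
      (sdiff_eq_empty.1 ((ncard_eq_zero
        (M.set_finite _ (sdiff_subset.trans hJ.subset_ground))).1 hn))
    exact ⟨M, A, hM, .refl, hE, hd, hJ, fun _ ↦ id⟩
  | succ n ih =>
    have := 𝓜.finite_of_mem M hM
    obtain ⟨t, ht⟩ := nonempty_of_ncard_ne_zero (hn.trans_ne n.succ_ne_zero)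
    obtain ⟨p, hp⟩ := M.ground_finite.exists_notMem
    -- Placed freely on the whole matroid, `p` can replace the element `t` of the base `J`.
    have hP := isFreeExt_freeExt (M := M) subset_rfl hp
    set P := freeExt M M.E p
    obtain ⟨N, A', hN, hPN, hNE, hNd, hA', hbase⟩ := ih (h.isFreeExt hM hP)
      (A := insert p A) (by rw [insert_union, hE, hP.ground_eq])
      (disjoint_insert_left.2 ⟨fun h ↦ hp (hE ▸ .inr h), hd⟩) (J := insert p (J \ {t}))
      (hP.isBase_exchange hJ ht.1)
      (insert_subset_insert (subset_sdiff_singleton hAJ ht.2)) (by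
        have hpJ : p ∉ J := fun hpJ ↦ hp (hJ.subset_ground hpJ)
        have hJA : insert p (J \ {t}) \ insert p A = (J \ A) \ {t} := by grind
        rw [hJA, ncard_sdiff_singleton_of_mem ht, hn, Nat.add_sub_cancel])
    have hMP : M ≤m P := ⟨∅, {p}, by rw [contract_empty, hP.delete_eq]⟩
    exact ⟨N, A', hN, hMP.trans hPN, hNE, hNd, hA', fun I hI ↦ hbase I (hP.isBase hI)⟩

lemma exists_isBase_partition (h : 𝓜.IsNatural) (hN : 𝓜.Mem N) :
    ∃ M A B, 𝓜.Mem M ∧ N ≤m M ∧ A ∪ B = M.E ∧ Disjoint A B ∧ M.IsBase A ∧ M.IsBase B := by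
  obtain ⟨M₁, B, hM₁, hNM₁, hE₁, hd₁, hA₁, hB₁⟩ := h.exists_indep_partition hN
  obtain ⟨M₂, A, hM₂, hM₁₂, hE₂, hd₂, hA₂, hbase₂⟩ := h.exists_isBase_superset hM₁ hE₁ hd₁ hA₁
  obtain ⟨J, hJ, hBJ⟩ := hB₁.exists_isBase_superset
  obtain ⟨M₃, B', hM₃, hM₂₃, hE₃, hd₃, hB₃, hbase⟩ := h.exists_isBase_superset hM₂
    (union_comm A B ▸ hE₂) hd₂.symm ((hbase₂ J hJ).indep.subset hBJ)
  exact ⟨M₃, A, B', hM₃, hNM₁.trans (hM₁₂.trans hM₂₃), union_comm B' A ▸ hE₃, hd₃.symm,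
    hbase A hA₂, hB₃⟩

lemma exists_isHyperplanePair (h : 𝓜.IsNatural) (hN : 𝓜.Mem N) :
    ∃ M A B z₁ z₂, 𝓜.Mem M ∧ IsHyperplanePair M A B z₁ z₂ ∧ N ≤m M ／ {z₁, z₂} ∧
      M.closure A = A ∧ M.closure B = B := by
  obtain ⟨M, A, B, hM, hNM, hE, hd, hA, hB⟩ := h.exists_isBase_partition hN
  have := 𝓜.finite_of_mem M hM
  obtain ⟨z₁, hz₁⟩ := M.ground_finite.exists_notMem
  obtain ⟨M₁, hM₁⟩ := exists_isColoopExtension hz₁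
  have hM₁𝓜 := h.coloop _ _ _ _ hM hM₁
  have := 𝓜.finite_of_mem M₁ hM₁𝓜
  obtain ⟨z₂, hz₂⟩ := M₁.ground_finite.exists_notMem
  obtain ⟨M₂, hM₂⟩ := exists_isColoopExtension hz₂
  have hbase {I : Set α} (hI : M.IsBase I) : M₂.IsBase (insert z₂ (insert z₁ I)) :=
    isBase_insert_of_isColoopExtension hM₂ (isBase_insert_of_isColoopExtension hM₁ hI)
  have hz₁₂ : z₁ ≠ z₂ := fun heq ↦ hz₂ (hM₁.2.1 ▸ .inl heq.symm)
  have hz₂M : z₂ ∉ M.E := fun hz ↦ hz₂ (hM₁.2.1 ▸ .inr hz)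
  have hpair : IsHyperplanePair M₂ (insert z₁ A) (insert z₂ B) z₁ z₂ := by
    refine ⟨?_, ?_, mem_insert _ _, mem_insert _ _, hbase hA, insert_comm z₁ z₂ B ▸ hbase hB⟩
    · rw [insert_union, union_insert, hE, hM₂.2.1, hM₁.2.1, insert_comm]
    · rw [disjoint_insert_left, disjoint_insert_right, mem_insert_iff, not_or]
      exact ⟨⟨hz₁₂, fun hz ↦ hz₁ (hB.subset_ground hz)⟩, fun hz ↦ hz₂M (hA.subset_ground hz), hd⟩
  obtain ⟨L, hL, hLpair, hLM, hflats⟩ := h.exists_flats (h.coloop _ _ _ _ hM₁𝓜 hM₂) hpair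
  refine ⟨L, _, _, z₁, z₂, hL, hLpair, ?_, hflats⟩
  rwa [hLM, pair_comm, ← singleton_union, ← contract_contract,
    contract_eq_of_isColoopExtension hM₂, contract_eq_of_isColoopExtension hM₁]

lemma exists_isGadget (h : 𝓜.IsNatural) (hN : 𝓜.Mem N) :
    ∃ G g g' A B, 𝓜.Mem G ∧ IsGadget G g g' A B ∧ N ≤m G ↾ (A ∪ B) := by
  have := 𝓜.finite_of_mem N hN
  obtain ⟨c, hc⟩ := N.ground_finite.exists_notMem
  obtain ⟨N', hN'⟩ := exists_isColoopExtension hc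
  obtain ⟨M, A, B, z₁, z₂, hM, hAB, hN'M, hA, hB⟩ :=
    h.exists_isHyperplanePair (h.coloop _ _ _ _ hN hN')
  have := 𝓜.finite_of_mem M hM
  obtain ⟨g, hg⟩ := M.ground_finite.exists_notMem
  have hP := isFreeExt_freeExt hAB.indep.subset_ground hg
  have := hP.finite
  obtain ⟨g', hg'⟩ := (freeExt M A g).ground_finite.exists_notMem
  have hBM := hAB.symm.indep.subset_ground
  have hG := isFreeExt_freeExt (hBM.trans hP.ground_subset) hg'
  refine ⟨_, g, g', A, B, h.isFreeExt (h.isFreeExt hM hP) hG,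
    hAB.isGadget hA hB ?_ (.of_isFreeExt hP hG hBM), ?_⟩
  · have hcM := hN'M.subset hN'.2.2.2.mem_ground
    have hz : ({z₁, z₂} : Set α) ⊆ M.E := pair_subset (hAB.union_eq ▸ .inl hAB.mem)
      (hAB.union_eq ▸ .inr hAB.mem')
    rw [← encard_eq_three.2 ⟨c, z₁, z₂, fun hc ↦ hcM.2 (.inl hc),
      fun hc ↦ hcM.2 (.inr hc), hAB.disjoint.ne_of_mem hAB.mem hAB.mem', rfl⟩]
    exact encard_le_encard (insert_subset hcM.1 hz)
  · have hMG := (hP.isRestriction.trans hG.isRestriction).eq_restrict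
    have hNN' : N ≤m N' := ⟨{c}, ∅, by rw [delete_empty, contract_eq_of_isColoopExtension hN']⟩
    rw [hAB.union_eq, hMG]
    exact hNN'.trans (hN'M.trans ⟨{z₁, z₂}, ∅, by rw [delete_empty]⟩)

end MatroidClass.IsNatural

theorem theorem5p2 (𝓜₁ 𝓜₂ : MatroidClass.{u})
    (h₁ : 𝓜₁.IsNatural) (h₂ : 𝓜₂.IsNatural) (hlt : 𝓜₁.ProperSubclass 𝓜₂)
    (hpin : 𝓜₁.ClosedUnderPinnedExtensions)
    {α : Type u} (N : Matroid α) (hN : 𝓜₁.Mem N) :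
    ∃ (β : Type u) (M N' : Matroid β),
      𝓜₁.IsExcludedMinor M ∧ 𝓜₂.Mem M ∧ N'.IsMinor M ∧ N.Isomorphic N' := by
  have := 𝓜₁.finite_of_mem N hN
  obtain ⟨φ, hφ, -⟩ := exists_map_disjoint (α := ULift.{u} ℕ) N finite_empty
  obtain ⟨G, g, g', A, B, hG₁, hG, hNG⟩ := h₁.exists_isGadget (h₁.map hN φ hφ)
  have := 𝓜₁.finite_of_mem G hG₁
  obtain ⟨R, e, e', p, Y, Y', hR, hR₂, hd⟩ :=
    MatroidClass.exists_isObstruction h₁ h₂ hlt hG₁ G.ground_finite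
  have := 𝓜₂.finite_of_mem R hR₂
  obtain ⟨L, hL₁, hL₂, hGL⟩ :=
    hR.exists_isExcludedMinor hG hd h₁ h₂ hpin hR₂ hG₁ (hlt.1 _ _ hG₁)
  exact ⟨_, L, _, hL₁, hL₂, hNG.trans hGL, isomorphic_map N φ hφ⟩
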